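/- **Conventions.** $t=(t_1,t_2,\dots)$ and $\bar t=(\bar t_1,\bar t_2,\dots)$ are sequences of complex times; $\{A,B\}_{\rm Toda}=p\,A_pB_s-p\,A_sB_p$ and $\{A,B\}=A_kB_x-A_xB_k$. *Toda twistor data* are two holomorphic functions $f(p,s),g(p,s)$ on an open set $D\subset\mathbb C^2$ with $\{f,g\}_{\rm Toda}=f$. A *corresponding quadruple* consists of constants $0\le r<R$, a set of parameters $(t,\bar t,s)$ that is open in the direction of each single variable, and functions $$\mathcal L=p+\sum_{n\ge0}u_np^{-n}\neq0\ (|p|>r),\qquad \bar{\mathcal L}^{-1}=\bar u_0p^{-1}+\sum_{n\ge0}\bar u_{n+1}p^{n},\ \ \bar u_0\ne0,\ \bar{\mathcal L}\ne0,\infty\ (0<|p|<R),$$ $$\mathcal M=\sum_{n\ge1}nt_n\mathcal L^n+s+\sum_{n\ge1}v_n\mathcal L^{-n},\qquad \bar{\mathcal M}=-\sum_{n\ge1}n\bar t_n\bar{\mathcal L}^{-n}+s+\sum_{n\ge1}\bar v_n\bar{\mathcal L}^{n}\qquad(r<|p|<R),$$ whose coefficients depend on $(t,\bar t,s)$, all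 series being convergent on the stated sets ($\sum v_n\mathcal L^{-n}$ on $|p|>r$, $\sum\bar v_n\bar{\mathcal L}^n$ on $0<|p|<R$), holomorphic in $p$ jointly with any one of the variables $t_n,\bar t_n,s$, and such that, for $r<|p|<R$, $(\mathcal L,\mathcal M)\in D$ and $$f(\mathcal L,\mathcal M)=\bar{\mathcal L},\qquad g(\mathcal L,\mathcal M)=\bar{\mathcal M}.$$ **Proposition.** Let $(f,g)$ be Toda twistor data on $D$. 1. The functions $$f_{\rm dmKP}(k,x,s)=f(k,kx),\qquad g_{\rm dmKP}(k,x,s)=\bigl(g(k,kx)-s\bigr)f(k,kx)^{-1}$$ are holomorphic on the open set $D'=\{(k,x,s):(k,kx)\in D,\ f(k,kx)\neq0\}$ and satisfy $\{f_{\rm dmKP},g_{\rm dmKP}\}=1$ there. 2. Let $(\mathcal L,\bar{\mathcal L},\mathcal M,\bar{\mathcal M})$ be a corresponding quadruple. For $(x,t,s)$ such that $(t',0,s)$, $t'=(t_1+x,t_2,t_3,\dots)$, is in its parameter set, put $u=u_0(t';0;s)$, the coefficient of $p^0$ in $\mathcal L$, and $$L(k)=\mathcal L\big|_{p=k-u},\qquad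 M(k)=\mathcal M\mathcal L^{-1}\big|_{p=k-u},\qquad P(k)=k-u,$$ where $\mathcal L,\mathcal M$ are taken at $(t',0,s)$. Then: (a) *(Twistor problem.)* For $r<|k-u|<R$ one has $(L,M,s)\in D'$. Put $\hat L=f_{\rm dmKP}(L,M,s)$, $\hat M=g_{\rm dmKP}(L,M,s)$, and write $(F)_{<0}=0$ if $F$ has no negative powers, that is, extends holomorphically from the annulus $r<|k-u|<R$ to the disc $|k-u|<R$. Then $$(\hat L)_{<0}=(\hat M)_{<0}=0,$$ $$\Bigl(P\,\tfrac{\partial\hat L}{\partial s}+\{P,\hat L\}-P\,\tfrac{\partial f_{\rm dmKP}}{\partial s}(L,M,s)\Bigr)_{<0}=0,\qquad \Bigl(P\,\tfrac{\partial\hat M}{\partial s}+\{P,\hat M\}-P\,\tfrac{\partial g_{\rm dmKP}}{\partial s}(L,M,s)\Bigr)_{<0}=0,$$ and also $\bigl(P\,\tfrac{\partial f_{\rm dmKP}}{\partial s}(L,M,s)\bigr)_{<0}=\bigl(P\,\tfrac{\partial g_{\rm dmKP}}{\partial s}(L,M,s)\bigr)_{<0}=0$. (b) *(Dispersionless mKP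 hierarchy, $N=1$.)* $L$ and $M$ are holomorphic in $k$ jointly with any one of $x,t_n,s$, on $|k-u|>r$ and $r<|k-u|<R$ respectively, and so is $P$ for all $k$; they have the form $$L=k+\sum_{n\ge1}\tilde u_{n+1}k^{-n}\ (k\to\infty),\quad M=\sum_{n\ge1}nt_nL^{n-1}+x+sL^{-1}+\sum_{n\ge1}\tilde v_nL^{-n-1},\quad P=k+p_0$$ with coefficients depending only on $(x,t,s)$; and with $B_n=(L^n)_{\ge0}$, the polynomial part of the Laurent series of $L^n$ at $k=\infty$, they satisfy for all $n\ge1$ $$\frac{\partial L}{\partial t_n}=\{B_n,L\},\qquad \frac{\partial M}{\partial t_n}=\{B_n,M\},\qquad \{L,M\}=1,$$ $$\frac{\partial L}{\partial s}P=\{P,L\},\qquad \frac{\partial M}{\partial s}P=\{P,M\},\qquad -\frac{\partial B_n}{\partial s}P=-\frac{\partial P}{\partial t_n}-\{P,B_n\}.$$ -/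

import Mathlib

open Filter Topology

noncomputable section

/-- The infinite sequences of times `(t₁, t₂, …)`. -/
abbrev Times : Type := ℕ+ → ℂ

/-! ### Twistor data -/

/-- Twistor data of the dispersionless Toda hierarchy: a pair of holomorphic functions `f(p,s)`,
`g(p,s)` on an open set `D` with `{f,g}_Toda = f`, where
`{A,B}_Toda = p A_p B_s - p A_s B_p`. -/
structure IsDTodaTwistorData (D : Set (ℂ × ℂ)) (f g : ℂ → ℂ → ℂ) : Prop where
  isOpen : IsOpen D
  hol_f : DifferentiableOn ℂ (fun z : ℂ × ℂ => f z.1 z.2) D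
  hol_g : DifferentiableOn ℂ (fun z : ℂ × ℂ => g z.1 z.2) D
  bracket : ∀ p s : ℂ, (p, s) ∈ D →
    p * deriv (fun q => f q s) p * deriv (fun σ => g p σ) s
      - p * deriv (fun σ => f p σ) s * deriv (fun q => g q s) p = f p s

/-- Twistor data of the dispersionless mKP hierarchy: a pair of holomorphic functions `f(k,x,s)`,
`g(k,x,s)` on an open set `D` with the canonical Poisson relation
`{f,g} = f_k g_x - f_x g_k = 1`. -/
structure IsDMKPTwistorData (D : Set (ℂ × ℂ × ℂ)) (f g : ℂ → ℂ → ℂ → ℂ) : Prop where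
  isOpen : IsOpen D
  hol_f : DifferentiableOn ℂ (fun z : ℂ × ℂ × ℂ => f z.1 z.2.1 z.2.2) D
  hol_g : DifferentiableOn ℂ (fun z : ℂ × ℂ × ℂ => g z.1 z.2.1 z.2.2) D
  bracket : ∀ k x s : ℂ, (k, x, s) ∈ D →
    deriv (fun q => f q x s) k * deriv (fun y => g k y s) x
      - deriv (fun y => f k y s) x * deriv (fun q => g q x s) k = 1

/-- `f_dmKP(k,x,s) = f_Toda(k,kx)`. -/
def fDMKP (f : ℂ → ℂ → ℂ) : ℂ → ℂ → ℂ → ℂ := fun k x _ => f k (k * x)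

/-- `g_dmKP(k,x,s) = (g_Toda(k,kx) - s) f_Toda(k,kx)⁻¹`. -/
def gDMKP (f g : ℂ → ℂ → ℂ) : ℂ → ℂ → ℂ → ℂ :=
  fun k x s => (g k (k * x) - s) * (f k (k * x))⁻¹

/-- The set of `(k,x,s)` at which the two formulas above make sense. -/
def dmkpTwistorDomain (D : Set (ℂ × ℂ)) (f : ℂ → ℂ → ℂ) : Set (ℂ × ℂ × ℂ) :=
  {z | (z.1, z.1 * z.2.1) ∈ D ∧ f z.1 (z.1 * z.2.1) ≠ 0}

/-! ### Quadruples of dispersionless Toda type -/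

/-- Four functions `L, L̄, M, M̄` of `(t, t̄, s; p)`, the parameters `(t, t̄, s)` running through
`dom`, with coefficients `u, ū, v, v̄` of their expansions. `L` lives on `r < |p|`, `L̄` on
`0 < |p| < R`, and `M`, `M̄` on the annulus `r < |p| < R`.
`u n` is the coefficient of `p⁻ⁿ` in `L`, and `ub 0`, `ub (n + 1)` are those of `p⁻¹`, `pⁿ` in
`L̄⁻¹`. -/
structure DTodaQuadruple where
  dom : Set (Times × Times × ℂ)
  r : ℝ
  R : ℝ
  L : Times → Times → ℂ → ℂ → ℂ
  Lb : Times → Times → ℂ → ℂ → ℂ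
  M : Times → Times → ℂ → ℂ → ℂ
  Mb : Times → Times → ℂ → ℂ → ℂ
  u : ℕ → Times → Times → ℂ → ℂ
  ub : ℕ → Times → Times → ℂ → ℂ
  v : ℕ+ → Times → Times → ℂ → ℂ
  vb : ℕ+ → Times → Times → ℂ → ℂ

namespace DTodaQuadruple

/-- `F(t, t̄, s; p)` is holomorphic, near the given point, in `p` together with any one of the
variables `t₁, t₂, …, t̄₁, t̄₂, …, s`. -/
def HolAt (F : Times → Times → ℂ → ℂ → ℂ) (t tb : Times) (s p : ℂ) : Prop :=
  (∀ n : ℕ+,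
    AnalyticAt ℂ (fun z : ℂ × ℂ => F (Function.update t n z.1) tb s z.2) (t n, p)) ∧
  (∀ n : ℕ+,
    AnalyticAt ℂ (fun z : ℂ × ℂ => F t (Function.update tb n z.1) s z.2) (tb n, p)) ∧
  AnalyticAt ℂ (fun z : ℂ × ℂ => F t tb z.1 z.2) (s, p)

/-- A set of parameters `(t, t̄, s)` that is open in the direction of each single variable. -/
def CoordOpen (Ω : Set (Times × Times × ℂ)) : Prop :=
  ∀ (t tb : Times) (s : ℂ), (t, tb, s) ∈ Ω →
    (∀ n : ℕ+, ∀ᶠ z in 𝓝 (t n), (Function.update t n z, tb, s) ∈ Ω) ∧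
    (∀ n : ℕ+, ∀ᶠ z in 𝓝 (tb n), (t, Function.update tb n z, s) ∈ Ω) ∧
    (∀ᶠ z in 𝓝 s, (t, tb, z) ∈ Ω)

/-- The functions are convergent series of the form
`L = p + ∑_{n ≥ 0} u_n p⁻ⁿ`, `L̄⁻¹ = ū₀ p⁻¹ + ∑_{n ≥ 0} ū_{n+1} pⁿ`,
`M = ∑_{n ≥ 1} n t_n Lⁿ + s + ∑_{n ≥ 1} v_n L⁻ⁿ`,
`M̄ = - ∑_{n ≥ 1} n t̄_n L̄⁻ⁿ + s + ∑_{n ≥ 1} v̄_n L̄ⁿ`, depending holomorphically on the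
parameters. -/
structure HasForm (S : DTodaQuadruple) : Prop where
  r_nonneg : 0 ≤ S.r
  r_lt_R : S.r < S.R
  dom_open : CoordOpen S.dom
  L_hol : ∀ t tb s, (t, tb, s) ∈ S.dom → ∀ p : ℂ, S.r < ‖p‖ → HolAt S.L t tb s p
  Lb_hol : ∀ t tb s, (t, tb, s) ∈ S.dom → ∀ p : ℂ, 0 < ‖p‖ → ‖p‖ < S.R →
    HolAt S.Lb t tb s p
  M_hol : ∀ t tb s, (t, tb, s) ∈ S.dom → ∀ p : ℂ, S.r < ‖p‖ → ‖p‖ < S.R →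
    HolAt S.M t tb s p
  Mb_hol : ∀ t tb s, (t, tb, s) ∈ S.dom → ∀ p : ℂ, S.r < ‖p‖ → ‖p‖ < S.R →
    HolAt S.Mb t tb s p
  L_ne : ∀ t tb s, (t, tb, s) ∈ S.dom → ∀ p : ℂ, S.r < ‖p‖ → S.L t tb s p ≠ 0
  Lb_ne : ∀ t tb s, (t, tb, s) ∈ S.dom → ∀ p : ℂ, 0 < ‖p‖ → ‖p‖ < S.R →
    S.Lb t tb s p ≠ 0
  ub_zero_ne : ∀ t tb s, (t, tb, s) ∈ S.dom → S.ub 0 t tb s ≠ 0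
  L_series : ∀ t tb s, (t, tb, s) ∈ S.dom → ∀ p : ℂ, S.r < ‖p‖ →
    HasSum (fun n : ℕ => S.u n t tb s * (p ^ n)⁻¹) (S.L t tb s p - p)
  Lb_series : ∀ t tb s, (t, tb, s) ∈ S.dom → ∀ p : ℂ, 0 < ‖p‖ → ‖p‖ < S.R →
    HasSum (fun n : ℕ => S.ub (n + 1) t tb s * p ^ n)
      ((S.Lb t tb s p)⁻¹ - S.ub 0 t tb s * p⁻¹)
  v_summable : ∀ t tb s, (t, tb, s) ∈ S.dom → ∀ p : ℂ, S.r < ‖p‖ →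
    Summable (fun n : ℕ+ => S.v n t tb s * (S.L t tb s p ^ (n : ℕ))⁻¹)
  vb_summable : ∀ t tb s, (t, tb, s) ∈ S.dom → ∀ p : ℂ, 0 < ‖p‖ → ‖p‖ < S.R →
    Summable (fun n : ℕ+ => S.vb n t tb s * S.Lb t tb s p ^ (n : ℕ))
  t_summable : ∀ t tb s, (t, tb, s) ∈ S.dom → ∀ p : ℂ, S.r < ‖p‖ → ‖p‖ < S.R →
    Summable (fun n : ℕ+ => (n : ℂ) * t n * S.L t tb s p ^ (n : ℕ))
  tb_summable : ∀ t tb s, (t, tb, s) ∈ S.dom → ∀ p : ℂ, S.r < ‖p‖ → ‖p‖ < S.R →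
    Summable (fun n : ℕ+ => (n : ℂ) * tb n * (S.Lb t tb s p ^ (n : ℕ))⁻¹)
  M_series : ∀ t tb s, (t, tb, s) ∈ S.dom → ∀ p : ℂ, S.r < ‖p‖ → ‖p‖ < S.R →
    S.M t tb s p = (∑' n : ℕ+, (n : ℂ) * t n * S.L t tb s p ^ (n : ℕ)) + s
      + ∑' n : ℕ+, S.v n t tb s * (S.L t tb s p ^ (n : ℕ))⁻¹
  Mb_series : ∀ t tb s, (t, tb, s) ∈ S.dom → ∀ p : ℂ, S.r < ‖p‖ → ‖p‖ < S.R →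
    S.Mb t tb s p = -(∑' n : ℕ+, (n : ℂ) * tb n * (S.Lb t tb s p ^ (n : ℕ))⁻¹) + s
      + ∑' n : ℕ+, S.vb n t tb s * S.Lb t tb s p ^ (n : ℕ)

/-- The quadruple corresponds to the twistor data `(f, g)`: it has the form above and
`f(L, M) = L̄`, `g(L, M) = M̄` on the annulus. -/
structure IsTwistorSolution (S : DTodaQuadruple) (D : Set (ℂ × ℂ)) (f g : ℂ → ℂ → ℂ) :
    Prop where
  form : S.HasForm
  mem : ∀ t tb s, (t, tb, s) ∈ S.dom → ∀ p : ℂ, S.r < ‖p‖ → ‖p‖ < S.R →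
    (S.L t tb s p, S.M t tb s p) ∈ D
  f_eq : ∀ t tb s, (t, tb, s) ∈ S.dom → ∀ p : ℂ, S.r < ‖p‖ → ‖p‖ < S.R →
    f (S.L t tb s p) (S.M t tb s p) = S.Lb t tb s p
  g_eq : ∀ t tb s, (t, tb, s) ∈ S.dom → ∀ p : ℂ, S.r < ‖p‖ → ‖p‖ < S.R →
    g (S.L t tb s p) (S.M t tb s p) = S.Mb t tb s p

end DTodaQuadruple

/-! ### The dispersionless mKP hierarchy with `N = 1` -/

/-- The derivative with respect to `x` of a function of `(x, t, s; k)`. -/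
def dX (F : ℂ → Times → ℂ → ℂ → ℂ) : ℂ → Times → ℂ → ℂ → ℂ :=
  fun x t s k => deriv (fun y => F y t s k) x

/-- The derivative with respect to `t_n`. -/
def dT (n : ℕ+) (F : ℂ → Times → ℂ → ℂ → ℂ) : ℂ → Times → ℂ → ℂ → ℂ :=
  fun x t s k => deriv (fun z => F x (Function.update t n z) s k) (t n)

/-- The derivative with respect to `s`. -/
def dS (F : ℂ → Times → ℂ → ℂ → ℂ) : ℂ → Times → ℂ → ℂ → ℂ :=
  fun x t s k => deriv (fun σ => F x t σ k) s

/-- The derivative with respect to `k`. -/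
def dK (F : ℂ → Times → ℂ → ℂ → ℂ) : ℂ → Times → ℂ → ℂ → ℂ :=
  fun x t s k => deriv (fun q => F x t s q) k

/-- The Poisson bracket `{F, G} = F_k G_x - F_x G_k`. -/
def poisson (F G : ℂ → Times → ℂ → ℂ → ℂ) : ℂ → Times → ℂ → ℂ → ℂ :=
  fun x t s k => dK F x t s k * dX G x t s k - dX F x t s k * dK G x t s k

/-- The polynomial part `(F)_{≥ 0}` of a Laurent series `F` at `k = ∞`: the polynomial `Q` with
`F(k) - Q(k) → 0` as `k → ∞`. -/
def polyPart (F : ℂ → ℂ) : Polynomial ℂ :=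
  Classical.epsilon fun Q : Polynomial ℂ =>
    Tendsto (fun k => F k - Q.eval k) (Bornology.cobounded ℂ) (𝓝 0)

theorem polyPart_eq (F : ℂ → ℂ) (Q : Polynomial ℂ)
    (h : Tendsto (fun k => F k - Q.eval k) (Bornology.cobounded ℂ) (𝓝 0)) :
    polyPart F = Q := by
  have h' : Tendsto (fun k => F k - (polyPart F).eval k) (Bornology.cobounded ℂ) (𝓝 0) :=
    Classical.epsilon_spec (p := fun Q : Polynomial ℂ =>
      Tendsto (fun k => F k - Q.eval k) (Bornology.cobounded ℂ) (𝓝 0)) ⟨Q, h⟩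
  have hd : Tendsto (fun k => (polyPart F - Q).eval k) (Bornology.cobounded ℂ) (𝓝 0) := by
    have := h.sub h'
    simpa using this
  have hdeg : ¬ 0 < (polyPart F - Q).degree := by
    intro hpos
    have h1 := Polynomial.tendsto_norm_atTop (polyPart F - Q) hpos
      (tendsto_norm_cobounded_atTop (E := ℂ))
    have h2 := hd.norm
    exact not_tendsto_nhds_of_tendsto_atTop h1 _ h2
  have hC := Polynomial.eq_C_of_degree_le_zero (not_lt.mp hdeg)
  rw [hC] at hd
  simp only [Polynomial.eval_C] at hd
  have h0 := tendsto_nhds_unique hd tendsto_const_nhds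
  rw [← h0, Polynomial.C_0] at hC
  exact sub_eq_zero.mp hC

/-- The vanishing `(F)_{< 0} = 0` for a function `F` on the annulus `r < |k - c| < R`: no negative
powers occur, that is, `F` is the restriction of a holomorphic function on the disc
`|k - c| < R`. (The part of the Laurent series of `F` in negative powers of `k - c` is also the
part that re-expands, at `k = ∞`, into negative powers of `k`.) -/
def NegPartVanishes (c : ℂ) (r R : ℝ) (F : ℂ → ℂ) : Prop :=
  ∃ G : ℂ → ℂ, DifferentiableOn ℂ G (Metric.ball c R) ∧
    ∀ k : ℂ, r < ‖k - c‖ → ‖k - c‖ < R → F k = G k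

/-- Three functions `L, M, P` of `(x, t, s; k)`, the parameters `(x, t, s)` running through `dom`.
`L` lives on `r < |k - c|` and `M` on the annulus `r < |k - c| < R`, where `c = c(x, t, s)`. -/
structure DMKPTriple where
  dom : Set (ℂ × Times × ℂ)
  c : ℂ → Times → ℂ → ℂ
  r : ℝ
  R : ℝ
  L : ℂ → Times → ℂ → ℂ → ℂ
  M : ℂ → Times → ℂ → ℂ → ℂ
  P : ℂ → Times → ℂ → ℂ → ℂ

namespace DMKPTriple

/-- `F(x, t, s; k)` is holomorphic, near the given point, in `k` together with any one of the
variables `x, t₁, t₂, …, s`. -/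
def HolAt (F : ℂ → Times → ℂ → ℂ → ℂ) (x : ℂ) (t : Times) (s k : ℂ) : Prop :=
  AnalyticAt ℂ (fun z : ℂ × ℂ => F z.1 t s z.2) (x, k) ∧
  (∀ n : ℕ+, AnalyticAt ℂ (fun z : ℂ × ℂ => F x (Function.update t n z.1) s z.2) (t n, k)) ∧
  AnalyticAt ℂ (fun z : ℂ × ℂ => F x t z.1 z.2) (s, k)

/-- A set of parameters `(x, t, s)` that is open in the direction of each single variable. -/
def CoordOpen (Ω : Set (ℂ × Times × ℂ)) : Prop :=
  ∀ (x : ℂ) (t : Times) (s : ℂ), (x, t, s) ∈ Ω →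
    (∀ᶠ z in 𝓝 x, (z, t, s) ∈ Ω) ∧
    (∀ n : ℕ+, ∀ᶠ z in 𝓝 (t n), (x, Function.update t n z, s) ∈ Ω) ∧
    (∀ᶠ z in 𝓝 s, (x, t, z) ∈ Ω)

/-- `k` lies outside the inner circle. -/
def outer (T : DMKPTriple) (x : ℂ) (t : Times) (s : ℂ) : Set ℂ :=
  {k | T.r < ‖k - T.c x t s‖}

/-- `k` lies in the annulus. -/
def annulus (T : DMKPTriple) (x : ℂ) (t : Times) (s : ℂ) : Set ℂ :=
  {k | T.r < ‖k - T.c x t s‖ ∧ ‖k - T.c x t s‖ < T.R}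

/-- The form of the unknowns for `N = 1`:
`L = k + ∑_{n ≥ 1} u_{n+1} k⁻ⁿ` near `k = ∞`,
`M = ∑_{n ≥ 1} n t_n Lⁿ⁻¹ + x + s L⁻¹ + ∑_{n ≥ 1} v_n L⁻ⁿ⁻¹`, `P = k + p₀`, with coefficients
that depend on `(x, t, s)`. -/
structure HasForm (T : DMKPTriple) : Prop where
  r_nonneg : 0 ≤ T.r
  r_lt_R : T.r < T.R
  dom_open : CoordOpen T.dom
  L_hol : ∀ x t s, (x, t, s) ∈ T.dom → ∀ k ∈ T.outer x t s, HolAt T.L x t s k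
  M_hol : ∀ x t s, (x, t, s) ∈ T.dom → ∀ k ∈ T.annulus x t s, HolAt T.M x t s k
  P_hol : ∀ x t s, (x, t, s) ∈ T.dom → ∀ k : ℂ, HolAt T.P x t s k
  L_ne : ∀ x t s, (x, t, s) ∈ T.dom → ∀ k ∈ T.outer x t s, T.L x t s k ≠ 0
  L_series : ∃ u : ℕ+ → ℂ → Times → ℂ → ℂ, ∀ x t s, (x, t, s) ∈ T.dom →
    ∀ᶠ k in Bornology.cobounded ℂ,
      HasSum (fun n : ℕ+ => u (n + 1) x t s * (k ^ (n : ℕ))⁻¹) (T.L x t s k - k)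
  M_series : ∃ v : ℕ+ → ℂ → Times → ℂ → ℂ, ∀ x t s, (x, t, s) ∈ T.dom →
    (∀ k ∈ T.outer x t s,
      Summable (fun n : ℕ+ => v n x t s * (T.L x t s k ^ ((n : ℕ) + 1))⁻¹)) ∧
    (∀ k ∈ T.annulus x t s,
      Summable (fun n : ℕ+ => (n : ℂ) * t n * T.L x t s k ^ ((n : ℕ) - 1)) ∧
      T.M x t s k = (∑' n : ℕ+, (n : ℂ) * t n * T.L x t s k ^ ((n : ℕ) - 1)) + x
        + s * (T.L x t s k)⁻¹
        + ∑' n : ℕ+, v n x t s * (T.L x t s k ^ ((n : ℕ) + 1))⁻¹)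
  P_form : ∃ p₀ : ℂ → Times → ℂ → ℂ, ∀ x t s, (x, t, s) ∈ T.dom →
    ∀ k : ℂ, T.P x t s k = k + p₀ x t s

/-- `B_n = (Lⁿ)_{≥ 0}`. -/
def B (T : DMKPTriple) (n : ℕ+) : ℂ → Times → ℂ → ℂ → ℂ :=
  fun x t s k => (polyPart fun q => T.L x t s q ^ (n : ℕ)).eval k

/-- `(L, M, P)` is a solution of the dispersionless mKP hierarchy with `N = 1`. -/
structure IsSolution (T : DMKPTriple) : Prop where
  form : T.HasForm
  lax_L : ∀ x t s, (x, t, s) ∈ T.dom → ∀ n : ℕ+, ∀ k ∈ T.outer x t s,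
    dT n T.L x t s k = poisson (T.B n) T.L x t s k
  lax_M : ∀ x t s, (x, t, s) ∈ T.dom → ∀ n : ℕ+, ∀ k ∈ T.annulus x t s,
    dT n T.M x t s k = poisson (T.B n) T.M x t s k
  ccr : ∀ x t s, (x, t, s) ∈ T.dom → ∀ k ∈ T.annulus x t s,
    poisson T.L T.M x t s k = 1
  L_P : ∀ x t s, (x, t, s) ∈ T.dom → ∀ k ∈ T.outer x t s,
    dS T.L x t s k * T.P x t s k = poisson T.P T.L x t s k
  M_P : ∀ x t s, (x, t, s) ∈ T.dom → ∀ k ∈ T.annulus x t s,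
    dS T.M x t s k * T.P x t s k = poisson T.P T.M x t s k
  B_P : ∀ x t s, (x, t, s) ∈ T.dom → ∀ n : ℕ+, ∀ k : ℂ,
    -(dS (T.B n) x t s k * T.P x t s k)
      = -dT n T.P x t s k - poisson T.P (T.B n) x t s k

/-- `h(L(s), M(s), s)` as a function of `(x, t, s; k)`. -/
def comp (T : DMKPTriple) (h : ℂ → ℂ → ℂ → ℂ) : ℂ → Times → ℂ → ℂ → ℂ :=
  fun x t s k => h (T.L x t s k) (T.M x t s k) s

/-- The partial derivative `∂h/∂s` of a function `h(k, x, s)`. -/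
def partialS (h : ℂ → ℂ → ℂ → ℂ) : ℂ → ℂ → ℂ → ℂ :=
  fun k x s => deriv (fun σ => h k x σ) s

/-- `(L, M, P)` solves the Riemann-Hilbert type problem with twistor data `(f, g)` on `D`: with
`L̂ = f(L, M, s)` and `M̂ = g(L, M, s)`, the conditions `(L̂)_{< 0} = (M̂)_{< 0} = 0`,
`(P ∂L̂/∂s + {P, L̂} - P (∂f/∂s)(L, M, s))_{< 0} = 0`, and the same for `M̂` and `g`;
moreover these last two in their reduced form `(P (∂f/∂s)(L, M, s))_{< 0} = 0` and
`(P (∂g/∂s)(L, M, s))_{< 0} = 0`. -/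
structure SolvesTwistorProblem (T : DMKPTriple) (D : Set (ℂ × ℂ × ℂ))
    (f g : ℂ → ℂ → ℂ → ℂ) : Prop where
  mem : ∀ x t s, (x, t, s) ∈ T.dom → ∀ k ∈ T.annulus x t s,
    (T.L x t s k, T.M x t s k, s) ∈ D
  f_neg : ∀ x t s, (x, t, s) ∈ T.dom →
    NegPartVanishes (T.c x t s) T.r T.R (fun k => T.comp f x t s k)
  g_neg : ∀ x t s, (x, t, s) ∈ T.dom →
    NegPartVanishes (T.c x t s) T.r T.R (fun k => T.comp g x t s k)
  f_flow : ∀ x t s, (x, t, s) ∈ T.dom →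
    NegPartVanishes (T.c x t s) T.r T.R (fun k =>
      T.P x t s k * dS (T.comp f) x t s k + poisson T.P (T.comp f) x t s k
        - T.P x t s k * T.comp (partialS f) x t s k)
  g_flow : ∀ x t s, (x, t, s) ∈ T.dom →
    NegPartVanishes (T.c x t s) T.r T.R (fun k =>
      T.P x t s k * dS (T.comp g) x t s k + poisson T.P (T.comp g) x t s k
        - T.P x t s k * T.comp (partialS g) x t s k)
  f_reduced : ∀ x t s, (x, t, s) ∈ T.dom →
    NegPartVanishes (T.c x t s) T.r T.R (fun k =>
      T.P x t s k * T.comp (partialS f) x t s k)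
  g_reduced : ∀ x t s, (x, t, s) ∈ T.dom →
    NegPartVanishes (T.c x t s) T.r T.R (fun k =>
      T.P x t s k * T.comp (partialS g) x t s k)

end DMKPTriple

/-! ### From Toda to mKP -/

/-- The sequence `(t₁ + x, t₂, t₃, …)`: `x` enters only in the combination `t₁ + x`. -/
def shiftTime (x : ℂ) (t : Times) : Times := Function.update t 1 (t 1 + x)

/-- The triple `L_dmKP = L_Toda`, `M_dmKP = M_Toda L_Toda⁻¹`, `P_dmKP = k - u₀(t; 0; s)`, at
`t̄ = 0` and with `p` replaced by `k - u₀(t; 0; s)`, where `u₀` is the coefficient of `p⁰` in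
`L_Toda` and the first time is `t₁ + x`. -/
def DTodaQuadruple.toDMKP (S : DTodaQuadruple) : DMKPTriple where
  dom := {z | (shiftTime z.1 z.2.1, 0, z.2.2) ∈ S.dom}
  c := fun x t s => S.u 0 (shiftTime x t) 0 s
  r := S.r
  R := S.R
  L := fun x t s k => S.L (shiftTime x t) 0 s (k - S.u 0 (shiftTime x t) 0 s)
  M := fun x t s k => S.M (shiftTime x t) 0 s (k - S.u 0 (shiftTime x t) 0 s)
    * (S.L (shiftTime x t) 0 s (k - S.u 0 (shiftTime x t) 0 s))⁻¹
  P := fun x t s k => k - S.u 0 (shiftTime x t) 0 s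

end

/-!
The mKP functions are the Toda functions at `t̄ = 0` in the variable `k = p + u₀`, so the work is to
derive the Toda equations from `f(L, M) = L̄`, `g(L, M) = M̄`. Two function classes on the annulus
`r < |p| < R` carry the argument. `NegPartVanishes` says that a function extends to the disc, and
`OuterExtends` that it extends to `|p| > r` with a finite value at infinity. A function in both
classes is constant (`OuterExtends.eq_of_negPartVanishes`, by Liouville), and both are stable under
algebra, under `∂/∂p`, and under derivatives in a parameter on which the function depends
holomorphically (`differentiableOn_deriv_of_extension`, by the Cauchy integral over a circle in the
annulus).

Write `M = ∑ n tₙ Lⁿ + s + V`, where `V = ∑ vₙ L⁻ⁿ` is the tail. The radius of convergence of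
`∑ n tₙ λⁿ` exceeds `|L(p)|` for each `p` in the annulus, as `|L|` has no local maximum; hence `V` is
holomorphic in `p` and any one parameter, belongs to the outer class, and vanishes at infinity. On
the inner side the simple zero of `L̄` at the origin makes `p / L̄`, `L̄ / p` and `(M̄ - s) / L̄`
holomorphic on the disc.

The chain rule and `{f, g} = f` identify the Jacobian determinants of `(L, M)`, divided by `L`, with
those of `(L̄, M̄)`, divided by `L̄`. The former are a polynomial in `p` plus a function of the outer
class that vanishes at infinity, the latter belong to the inner class, so Liouville's theorem
evaluates them: with `Bₙ` the polynomial part of `Lⁿ` in `p`, the determinants in the variables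
`(p, s)`, `(p, tₙ)` and `(s, tₙ)` are `L / p`, `L ∂Bₙ/∂p` and `L ∂Bₙ/∂s` (`jacobianP_none`,
`jacobianP_some`, `jacobianS_some`). Three vectors in the plane are related linearly through their
determinants, which gives `∂L/∂tₙ = p (∂Bₙ/∂p ∂L/∂s - ∂Bₙ/∂s ∂L/∂p)` and the same for `M`. The
zero-curvature equation of the flows `t₁` and `tₙ` follows by comparing Laurent coefficients.

In the variable `k` one has `∂/∂s ↦ ∂/∂s - u₀,ₛ ∂/∂p` and likewise for the other parameters, and `u₀`
drops out of Poisson brackets. The equations with `P` then state the `t₁`-flow, since `B₁ = p + u₀`;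
the Lax equations combine the flows `t₁` and `tₙ` with the zero-curvature equation, and the equation
for `Bₙ` and `P` is the zero-curvature equation itself.
-/

/-! ### Integrals and Cauchy extensions with a parameter -/

/-- The set `r < |p|`. -/
def outerSet (r : ℝ) : Set ℂ := {p | r < ‖p‖}

/-- The annulus `r < |p| < R` about the origin. -/
def ringSet (r R : ℝ) : Set ℂ := {p | r < ‖p‖ ∧ ‖p‖ < R}

theorem isOpen_outerSet (r : ℝ) : IsOpen (outerSet r) := isOpen_lt continuous_const continuous_norm

theorem isOpen_ringSet (r R : ℝ) : IsOpen (ringSet r R) :=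
  (isOpen_lt continuous_const continuous_norm).inter (isOpen_lt continuous_norm continuous_const)

theorem ringSet_subset_outerSet (r R : ℝ) : ringSet r R ⊆ outerSet r := fun _ h => h.1

theorem mem_ringSet_of_norm_sub_zero {r R : ℝ} {p : ℂ} (hp : r < ‖p - 0‖) (hp' : ‖p - 0‖ < R) :
    p ∈ ringSet r R := ⟨by simpa using hp, by simpa using hp'⟩

theorem ringSet_nonempty {r R : ℝ} (hr : 0 ≤ r) (hrR : r < R) : (ringSet r R).Nonempty := by
  refine ⟨((r + R) / 2 : ℝ), ?_⟩
  have h : ‖(((r + R) / 2 : ℝ) : ℂ)‖ = (r + R) / 2 := by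
    rw [Complex.norm_real, Real.norm_of_nonneg (by linarith)]
  constructor <;> rw [h] <;> linarith

theorem ne_zero_of_mem_outerSet {r : ℝ} (hr : 0 ≤ r) {p : ℂ} (hp : p ∈ outerSet r) : p ≠ 0 :=
  norm_pos_iff.mp (hr.trans_lt hp)

/-- The outer set is the image of a half-plane (or of the plane) under the exponential map. -/
theorem isPreconnected_outerSet {r : ℝ} (hr : 0 ≤ r) : IsPreconnected (outerSet r) := by
  have hconv : IsPreconnected {z : ℂ | r < Real.exp z.re} := by
    have : Convex ℝ {z : ℂ | r < Real.exp z.re} := by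
      have h1 : Set.OrdConnected {y : ℝ | r < Real.exp y} :=
        ⟨fun a ha b hb c hc => lt_of_lt_of_le ha (Real.exp_le_exp.mpr hc.1)⟩
      exact h1.convex.linear_preimage Complex.reLm
    exact this.isPreconnected
  have himg : outerSet r = Complex.exp '' {z : ℂ | r < Real.exp z.re} := by
    ext p
    constructor
    · intro hp
      refine ⟨Complex.log p, ?_, Complex.exp_log (ne_zero_of_mem_outerSet hr hp)⟩
      have : ‖Complex.exp (Complex.log p)‖ = ‖p‖ := by
        rw [Complex.exp_log (ne_zero_of_mem_outerSet hr hp)]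
      rw [Complex.norm_exp] at this
      show r < Real.exp _
      rw [this]
      exact hp
    · rintro ⟨z, hz, rfl⟩
      simpa [outerSet, Complex.norm_exp] using hz
  rw [himg]
  exact hconv.image _ Complex.continuous_exp.continuousOn

theorem AnalyticAt.deriv_fst {F : ℂ → ℂ → ℂ} {z₀ q : ℂ}
    (hF : AnalyticAt ℂ (fun x : ℂ × ℂ => F x.1 x.2) (z₀, q)) :
    AnalyticAt ℂ (fun x : ℂ × ℂ => deriv (fun z => F z x.2) x.1) (z₀, q) := by
  have h1 : AnalyticAt ℂ (fun x => fderiv ℂ (fun x : ℂ × ℂ => F x.1 x.2) x ((1 : ℂ), (0 : ℂ)))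
      (z₀, q) :=
    ((ContinuousLinearMap.apply ℂ ℂ ((1 : ℂ), (0 : ℂ))).analyticAt _).comp hF.fderiv
  refine h1.congr ?_
  filter_upwards [hF.eventually_analyticAt] with x hx
  have hd : HasFDerivAt (fun x : ℂ × ℂ => F x.1 x.2) _ (x.1, x.2) :=
    hx.differentiableAt.hasFDerivAt
  have hg : HasDerivAt (fun z : ℂ => (z, x.2)) ((1 : ℂ), (0 : ℂ)) x.1 :=
    (hasDerivAt_id x.1).prodMk (hasDerivAt_const _ _)
  exact (hd.comp_hasDerivAt x.1 hg).deriv.symm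

theorem AnalyticAt.curry_fst' {F : ℂ → ℂ → ℂ} {z₀ q : ℂ}
    (hF : AnalyticAt ℂ (fun x : ℂ × ℂ => F x.1 x.2) (z₀, q)) :
    AnalyticAt ℂ (fun z => F z q) z₀ :=
  AnalyticAt.fun_comp (f := fun z : ℂ => (z, q)) hF (by fun_prop)

theorem AnalyticAt.curry_snd' {F : ℂ → ℂ → ℂ} {z₀ q : ℂ}
    (hF : AnalyticAt ℂ (fun x : ℂ × ℂ => F x.1 x.2) (z₀, q)) :
    AnalyticAt ℂ (fun w => F z₀ w) q :=
  AnalyticAt.fun_comp (f := fun w : ℂ => (z₀, w)) hF (by fun_prop)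

theorem hasDerivAt_circleIntegral_param {F : ℂ → ℂ → ℂ} {z₀ : ℂ} {c : ℝ} (hc : 0 < c)
    (hF : ∀ q : ℂ, ‖q‖ = c → AnalyticAt ℂ (fun x : ℂ × ℂ => F x.1 x.2) (z₀, q)) :
    HasDerivAt (fun z => ∮ q in C(0, c), F z q) (∮ q in C(0, c), deriv (fun z => F z q) z₀) z₀ := by
  set U : Set (ℂ × ℂ) := {x | AnalyticAt ℂ (fun x : ℂ × ℂ => F x.1 x.2) x} with hU
  have hUo : IsOpen U := isOpen_analyticAt ℂ _
  have hsub : ({z₀} : Set ℂ) ×ˢ Metric.sphere (0 : ℂ) c ⊆ U := by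
    rintro ⟨z, q⟩ ⟨hz, hq⟩
    obtain rfl : z = z₀ := hz
    exact hF q (by simpa using hq)
  obtain ⟨u, v, huo, hvo, hzu, hv, huv⟩ := generalized_tube_lemma isCompact_singleton
    (isCompact_sphere (0 : ℂ) c) hUo hsub
  obtain ⟨ε, hε, hεu⟩ := Metric.nhds_basis_closedBall.mem_iff.mp
    (huo.mem_nhds (hzu rfl : z₀ ∈ u))
  have hana : ∀ z ∈ Metric.closedBall z₀ ε, ∀ q : ℂ, ‖q‖ = c →
      AnalyticAt ℂ (fun x : ℂ × ℂ => F x.1 x.2) (z, q) := fun z hz q hq =>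
    huv ⟨hεu hz, hv (by simpa using hq)⟩
  have hcm : ∀ θ : ℝ, ‖circleMap 0 c θ‖ = c := fun θ => by
    rw [norm_circleMap_zero, abs_of_pos hc]
  have hdc : Continuous (deriv (circleMap 0 c)) := by
    have : deriv (circleMap 0 c) = fun θ => circleMap 0 c θ * Complex.I := by
      funext θ
      simp
    rw [this]
    fun_prop
  have hcont : ContinuousOn (fun x : ℂ × ℂ => deriv (fun z => F z x.2) x.1)
      (Metric.closedBall z₀ ε ×ˢ Metric.sphere (0 : ℂ) c) := fun x hx =>
    (hana x.1 hx.1 x.2 (by simpa using hx.2)).deriv_fst.continuousAt.continuousWithinAt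
  obtain ⟨C, hC⟩ := ((isCompact_closedBall z₀ ε).prod
    (isCompact_sphere (0 : ℂ) c)).exists_bound_of_continuousOn hcont
  have hFc : ∀ z ∈ Metric.closedBall z₀ ε,
      Continuous (fun θ : ℝ => deriv (circleMap 0 c) θ • F z (circleMap 0 c θ)) := by
    intro z hz
    refine Continuous.smul hdc ?_
    rw [continuous_iff_continuousAt]
    intro θ
    exact ContinuousAt.comp (f := circleMap 0 c) (g := fun q => F z q)
      (hana z hz _ (hcm θ)).curry_snd'.continuousAt (by fun_prop)
  have hFc' : Continuous
      (fun θ : ℝ => deriv (circleMap 0 c) θ • deriv (fun z => F z (circleMap 0 c θ)) z₀) := by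
    refine Continuous.smul hdc ?_
    rw [continuous_iff_continuousAt]
    intro θ
    have h := (hana z₀ (Metric.mem_closedBall_self hε.le) _ (hcm θ)).deriv_fst
    exact ContinuousAt.comp (f := circleMap 0 c) (g := fun q => deriv (fun z => F z q) z₀)
      (AnalyticAt.curry_snd' (F := fun a b => deriv (fun z => F z b) a) h).continuousAt (by fun_prop)
  have key := intervalIntegral.hasDerivAt_integral_of_dominated_loc_of_deriv_le
    (𝕜 := ℂ) (μ := MeasureTheory.volume) (a := 0) (b := 2 * Real.pi)
    (F := fun z θ => deriv (circleMap 0 c) θ • F z (circleMap 0 c θ))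
    (F' := fun z θ => deriv (circleMap 0 c) θ • deriv (fun z => F z (circleMap 0 c θ)) z)
    (x₀ := z₀) (s := Metric.closedBall z₀ ε) (bound := fun _ => c * C)
    (Metric.closedBall_mem_nhds z₀ hε) ?_ ?_ ?_ ?_ ?_ ?_
  · exact key.2
  · filter_upwards [Metric.closedBall_mem_nhds z₀ hε] with z hz
    exact (hFc z hz).aestronglyMeasurable
  · exact (hFc z₀ (Metric.mem_closedBall_self hε.le)).intervalIntegrable _ _
  · exact hFc'.aestronglyMeasurable
  · refine Eventually.of_forall fun θ _ z hz => ?_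
    rw [norm_smul]
    have h1 : ‖deriv (circleMap 0 c) θ‖ = c := by
      simp [deriv_circleMap, abs_of_pos hc]
    rw [h1]
    exact mul_le_mul_of_nonneg_left
      (hC (z, circleMap 0 c θ) ⟨hz, by simpa using hcm θ⟩) hc.le
  · exact intervalIntegrable_const
  · refine Eventually.of_forall fun θ _ z hz => ?_
    exact ((hana z hz _ (hcm θ)).curry_fst'.differentiableAt.hasDerivAt).const_mul _

/-- If `F(z, q)` is holomorphic jointly on a ring and extends, for each `z`, to `E(z, q)` on the
disc, then `E` is differentiable in `z`, and its derivative is holomorphic on the disc: on smaller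
discs `E` is the Cauchy integral of `F` over a circle in the ring. -/
theorem differentiableOn_deriv_of_extension {F E : ℂ → ℂ → ℂ} {z₀ : ℂ} {r R : ℝ} (hr : 0 ≤ r)
    (hrR : r < R)
    (hF : ∀ q ∈ ringSet r R, AnalyticAt ℂ (fun x : ℂ × ℂ => F x.1 x.2) (z₀, q))
    (hE : ∀ᶠ z in 𝓝 z₀, DifferentiableOn ℂ (E z) (Metric.ball 0 R) ∧
      ∀ q ∈ ringSet r R, F z q = E z q) :
    DifferentiableOn ℂ (fun w => deriv (fun z => E z w) z₀) (Metric.ball 0 R) ∧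
      ∀ w ∈ Metric.ball (0 : ℂ) R, DifferentiableAt ℂ (fun z => E z w) z₀ := by
  have key : ∀ c : ℝ, r < c → c < R → ∀ w : ℂ, ‖w‖ < c →
      HasDerivAt (fun z => E z w) ((2 * Real.pi * Complex.I : ℂ)⁻¹ •
        ∮ q in C(0, c), (q - w)⁻¹ • deriv (fun z => F z q) z₀) z₀ := by
    intro c hrc hcR w hw
    have hc : 0 < c := hr.trans_lt hrc
    have h1 := hasDerivAt_circleIntegral_param (F := fun z q => (q - w)⁻¹ • F z q) (z₀ := z₀) hc
      (by
        intro q hq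
        have h0 : AnalyticAt ℂ (fun x : ℂ × ℂ => x.2 - w) (z₀, q) :=
          analyticAt_snd.sub analyticAt_const
        refine AnalyticAt.smul (h0.inv ?_) (hF q ⟨hq ▸ hrc, hq ▸ hcR⟩)
        show q - w ≠ 0
        rw [sub_ne_zero]
        rintro rfl
        exact hw.ne hq)
    have h2 : (∮ q in C(0, c), deriv (fun z => (q - w)⁻¹ • F z q) z₀)
        = ∮ q in C(0, c), (q - w)⁻¹ • deriv (fun z => F z q) z₀ := by
      refine circleIntegral.integral_congr hc.le fun q hq => ?_
      have hq' : ‖q‖ = c := by simpa using hq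
      exact deriv_const_mul _ (hF q ⟨hq' ▸ hrc, hq' ▸ hcR⟩).curry_fst'.differentiableAt
    rw [h2] at h1
    refine (h1.const_smul (2 * Real.pi * Complex.I : ℂ)⁻¹).congr_of_eventuallyEq ?_
    filter_upwards [hE] with z hz
    have hcl : DiffContOnCl ℂ (E z) (Metric.ball 0 c) := by
      refine DifferentiableOn.diffContOnCl ?_
      refine hz.1.mono ?_
      rw [closure_ball _ hc.ne']
      exact Metric.closedBall_subset_ball hcR
    have h3 := hcl.two_pi_i_inv_smul_circleIntegral_sub_inv_smul (w := w) (by simpa using hw)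
    rw [← h3]
    congr 1
    refine circleIntegral.integral_congr hc.le fun q hq => ?_
    have hq' : ‖q‖ = c := by simpa using hq
    rw [hz.2 q ⟨hq' ▸ hrc, hq' ▸ hcR⟩]
  have hmid : ∀ w ∈ Metric.ball (0 : ℂ) R, ∃ c : ℝ, r < c ∧ c < R ∧ ‖w‖ < c := by
    intro w hw
    obtain ⟨c, hc1, hc2⟩ := exists_between (max_lt hrR (by simpa using hw : ‖w‖ < R))
    exact ⟨c, (le_max_left _ _).trans_lt hc1, hc2, (le_max_right _ _).trans_lt hc1⟩
  refine ⟨fun w hw => ?_, fun w hw => ?_⟩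
  · obtain ⟨c, hrc, hcR, hwc⟩ := hmid w hw
    have hc : 0 < c := hr.trans_lt hrc
    have hci : CircleIntegrable (fun q => deriv (fun z => F z q) z₀) 0 c := by
      refine ContinuousOn.circleIntegrable hc.le fun q hq => ?_
      have hq' : ‖q‖ = c := by simpa using hq
      exact (AnalyticAt.curry_snd' (F := fun a b => deriv (fun z => F z b) a)
        (hF q ⟨hq' ▸ hrc, hq' ▸ hcR⟩).deriv_fst).continuousAt.continuousWithinAt
    lift c to NNReal using hc.le
    have hps := hasFPowerSeriesOn_cauchy_integral hci (by exact_mod_cast hc)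
    have hd := hps.differentiableOn
    rw [Metric.eball_coe] at hd
    have hwb : w ∈ Metric.ball (0 : ℂ) (c : ℝ) := by simpa using hwc
    refine DifferentiableAt.differentiableWithinAt ?_
    refine (hd.differentiableAt (Metric.isOpen_ball.mem_nhds hwb)).congr_of_eventuallyEq ?_
    filter_upwards [Metric.isOpen_ball.mem_nhds hwb] with v hv
    exact (key c hrc hcR v (by simpa using hv)).deriv
  · obtain ⟨c, hrc, hcR, hwc⟩ := hmid w hw
    exact (key c hrc hcR w hwc).differentiableAt

/-! ### Functions holomorphic at infinity -/

/-- `E` is holomorphic on `r < |p|`, and at `p = ∞` with the value `e`. -/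
structure HolAtInfty (r : ℝ) (E : ℂ → ℂ) (e : ℂ) : Prop where
  diff : DifferentiableOn ℂ E (outerSet r)
  lim : Tendsto E (Bornology.cobounded ℂ) (𝓝 e)

/-- `F`, on the annulus `r < |p| < R`, has no positive powers, and the constant term `e`: it is
the restriction of a function that is holomorphic on `r < |p|` and has the value `e` at `∞`. -/
def OuterExtends (r R : ℝ) (F : ℂ → ℂ) (e : ℂ) : Prop :=
  ∃ E : ℂ → ℂ, HolAtInfty r E e ∧ Set.EqOn F E (ringSet r R)

theorem eventually_cobounded_mem_outerSet (r : ℝ) :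
    ∀ᶠ p in Bornology.cobounded ℂ, p ∈ outerSet r :=
  tendsto_norm_cobounded_atTop.eventually (eventually_gt_atTop r)

namespace HolAtInfty

variable {r : ℝ} {E E' : ℂ → ℂ} {e e' : ℂ}

theorem const (r : ℝ) (e : ℂ) : HolAtInfty r (fun _ => e) e :=
  ⟨differentiableOn_const _, tendsto_const_nhds⟩

theorem inv_id (hr : 0 ≤ r) : HolAtInfty r (fun p => p⁻¹) 0 :=
  ⟨differentiableOn_id.inv fun _ hp => ne_zero_of_mem_outerSet hr hp, tendsto_inv₀_cobounded⟩

theorem add (h : HolAtInfty r E e) (h' : HolAtInfty r E' e') :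
    HolAtInfty r (fun p => E p + E' p) (e + e') := ⟨h.diff.add h'.diff, h.lim.add h'.lim⟩

theorem sub (h : HolAtInfty r E e) (h' : HolAtInfty r E' e') :
    HolAtInfty r (fun p => E p - E' p) (e - e') := ⟨h.diff.sub h'.diff, h.lim.sub h'.lim⟩

theorem mul (h : HolAtInfty r E e) (h' : HolAtInfty r E' e') :
    HolAtInfty r (fun p => E p * E' p) (e * e') := ⟨h.diff.mul h'.diff, h.lim.mul h'.lim⟩

theorem pow (h : HolAtInfty r E e) (n : ℕ) :
    HolAtInfty r (fun p => E p ^ n) (e ^ n) := ⟨h.diff.pow n, h.lim.pow n⟩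

theorem inv (h : HolAtInfty r E e) (hE : ∀ p ∈ outerSet r, E p ≠ 0) (he : e ≠ 0) :
    HolAtInfty r (fun p => (E p)⁻¹) e⁻¹ := ⟨h.diff.inv hE, h.lim.inv₀ he⟩

theorem congr (h : HolAtInfty r E e) (hE : Set.EqOn E' E (outerSet r)) : HolAtInfty r E' e :=
  ⟨h.diff.congr hE, h.lim.congr' <| by
    filter_upwards [eventually_cobounded_mem_outerSet r] with p hp using (hE hp).symm⟩

theorem differentiableOn_chart (h : HolAtInfty r E e) {r' : ℝ} (hr' : 0 < r') (hrr : r ≤ r') :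
    DifferentiableOn ℂ (fun w => if w = 0 then e else E w⁻¹) (Metric.ball 0 r'⁻¹) := by
  have h0 : (0 : ℂ) ∈ Metric.ball (0 : ℂ) r'⁻¹ := Metric.mem_ball_self (inv_pos.mpr hr')
  refine (Complex.differentiableOn_compl_singleton_and_continuousAt_iff
    (Metric.isOpen_ball.mem_nhds h0)).mp ⟨?_, ?_⟩
  · have h1 : DifferentiableOn ℂ (fun w => E w⁻¹) (Metric.ball (0 : ℂ) r'⁻¹ \ {0}) := by
      refine h.diff.comp (differentiableOn_id.inv fun w hw => hw.2) fun w hw => ?_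
      have hw1 : ‖w‖ < r'⁻¹ := by simpa using hw.1
      have hw0 : 0 < ‖w‖ := norm_pos_iff.mpr hw.2
      show r < ‖w⁻¹‖
      rw [norm_inv]
      exact hrr.trans_lt (by rwa [lt_inv_comm₀ hr' hw0])
    exact h1.congr fun w hw => if_neg hw.2
  · rw [← continuousWithinAt_compl_self]
    show Tendsto _ _ (𝓝 (if (0 : ℂ) = 0 then e else _))
    rw [if_pos rfl]
    refine Tendsto.congr' ?_ (h.lim.comp tendsto_inv₀_nhdsNE_zero)
    filter_upwards [self_mem_nhdsWithin] with w hw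
    exact (if_neg hw).symm

/-- The value at infinity is the value at `0` in the coordinate `w = p⁻¹`. -/
theorem of_chart {A : ℂ → ℂ} (hE : DifferentiableOn ℂ E (outerSet r)) {r' : ℝ}
    (hr' : 0 < r') (hA : ContinuousAt A 0)
    (hEA : ∀ w : ℂ, w ≠ 0 → ‖w‖ < r'⁻¹ → E w⁻¹ = A w) : HolAtInfty r E (A 0) := by
  refine ⟨hE, ?_⟩
  refine (hA.tendsto.comp (tendsto_inv₀_cobounded (α := ℂ))).congr' ?_
  filter_upwards [eventually_cobounded_mem_outerSet r'] with p hp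
  have hp' : r' < ‖p‖ := hp
  have h0 : p ≠ 0 := norm_pos_iff.mp (hr'.trans hp')
  have := hEA p⁻¹ (inv_ne_zero h0) (by
    rw [norm_inv]; exact inv_strictAnti₀ hr' hp')
  simpa using this.symm

theorem exists_peel (hr : 0 ≤ r) (h : HolAtInfty r E e) :
    ∃ e₁, HolAtInfty r (fun p => p * (E p - e)) e₁ := by
  have hr' : 0 < r + 1 := by linarith
  have hd := h.differentiableOn_chart hr' (by linarith)
  set A : ℂ → ℂ := fun w => if w = 0 then e else E w⁻¹ with hA
  have h0 : Metric.ball (0 : ℂ) (r + 1)⁻¹ ∈ 𝓝 (0 : ℂ) :=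
    Metric.ball_mem_nhds _ (inv_pos.mpr hr')
  have hA1 := (Complex.differentiableOn_dslope h0).mpr hd
  refine ⟨dslope A 0 0, of_chart (differentiableOn_id.mul (h.diff.sub_const e)) hr'
    (hA1.differentiableAt h0).continuousAt fun w hw _ => ?_⟩
  rw [dslope_of_ne _ hw, slope_def_field]
  simp only [hA, if_neg hw, if_pos rfl, sub_zero]
  field_simp

theorem mul_deriv (hr : 0 ≤ r) (h : HolAtInfty r E e) :
    HolAtInfty r (fun p => p * deriv E p) 0 := by
  have hr' : 0 < r + 1 := by linarith
  have hd := h.differentiableOn_chart hr' (by linarith)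
  set A : ℂ → ℂ := fun w => if w = 0 then e else E w⁻¹ with hA
  have hA1 : ContinuousAt (fun w => -w * deriv A w) 0 := by
    have := (hd.deriv Metric.isOpen_ball).differentiableAt
      (Metric.ball_mem_nhds (0 : ℂ) (inv_pos.mpr hr'))
    exact continuousAt_id.neg.mul this.continuousAt
  have key := of_chart (E := fun p => p * deriv E p) (A := fun w => -w * deriv A w)
    (differentiableOn_id.mul (h.diff.deriv (isOpen_outerSet r))) hr' hA1 (fun w hw hwr => by
      have hmem : w⁻¹ ∈ outerSet r := by
        show r < ‖w⁻¹‖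
        rw [norm_inv]
        have : r + 1 < ‖w‖⁻¹ := by rwa [lt_inv_comm₀ hr' (norm_pos_iff.mpr hw)]
        linarith
      have h1 : HasDerivAt A (deriv E w⁻¹ * (-(w ^ 2)⁻¹)) w := by
        have h2 : HasDerivAt (fun w => E w⁻¹) (deriv E w⁻¹ * (-(w ^ 2)⁻¹)) w :=
          (h.diff.differentiableAt ((isOpen_outerSet r).mem_nhds hmem)).hasDerivAt.comp w
            (hasDerivAt_inv hw)
        refine h2.congr_of_eventuallyEq ?_
        filter_upwards [isOpen_ne.mem_nhds hw] with v hv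
        exact if_neg hv
      rw [h1.deriv]
      field_simp)
  simpa using key

theorem deriv (hr : 0 ≤ r) (h : HolAtInfty r E e) : HolAtInfty r (deriv E) 0 := by
  have := (inv_id hr).mul (h.mul_deriv hr)
  simp only [mul_zero] at this
  refine this.congr fun p hp => ?_
  have := ne_zero_of_mem_outerSet hr hp
  field_simp

end HolAtInfty

/-! ### Functions on the annulus with one-sided expansions -/

namespace OuterExtends

variable {r R : ℝ} {F F' : ℂ → ℂ} {e e' : ℂ}

theorem _root_.HolAtInfty.outerExtends (h : HolAtInfty r F e) (R : ℝ) : OuterExtends r R F e :=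
  ⟨F, h, fun _ _ => rfl⟩

theorem congr (h : OuterExtends r R F e) (hF : Set.EqOn F' F (ringSet r R)) :
    OuterExtends r R F' e :=
  let ⟨E, hE, hFE⟩ := h
  ⟨E, hE, hF.trans hFE⟩

theorem add (h : OuterExtends r R F e) (h' : OuterExtends r R F' e') :
    OuterExtends r R (fun p => F p + F' p) (e + e') :=
  let ⟨_, hE, hFE⟩ := h
  let ⟨_, hE', hFE'⟩ := h'
  ⟨_, hE.add hE', fun p hp => by simp only [hFE hp, hFE' hp]⟩

theorem sub (h : OuterExtends r R F e) (h' : OuterExtends r R F' e') :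
    OuterExtends r R (fun p => F p - F' p) (e - e') :=
  let ⟨_, hE, hFE⟩ := h
  let ⟨_, hE', hFE'⟩ := h'
  ⟨_, hE.sub hE', fun p hp => by simp only [hFE hp, hFE' hp]⟩

theorem mul (h : OuterExtends r R F e) (h' : OuterExtends r R F' e') :
    OuterExtends r R (fun p => F p * F' p) (e * e') :=
  let ⟨_, hE, hFE⟩ := h
  let ⟨_, hE', hFE'⟩ := h'
  ⟨_, hE.mul hE', fun p hp => by simp only [hFE hp, hFE' hp]⟩

theorem deriv (hr : 0 ≤ r) (h : OuterExtends r R F e) : OuterExtends r R (deriv F) 0 := by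
  obtain ⟨E, hE, hFE⟩ := h
  refine ⟨_, hE.deriv hr, fun p hp => Filter.EventuallyEq.deriv_eq ?_⟩
  filter_upwards [(isOpen_ringSet r R).mem_nhds hp] with q hq using hFE hq

theorem mul_deriv (hr : 0 ≤ r) (h : OuterExtends r R F e) :
    OuterExtends r R (fun p => p * _root_.deriv F p) 0 := by
  obtain ⟨E, hE, hFE⟩ := h
  refine ⟨_, hE.mul_deriv hr, fun p hp => ?_⟩
  have : _root_.deriv F p = _root_.deriv E p := by
    refine Filter.EventuallyEq.deriv_eq ?_
    filter_upwards [(isOpen_ringSet r R).mem_nhds hp] with q hq using hFE hq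
  simp only [this]

/-- The parameter derivative of a holomorphic family of functions without positive powers has no
positive powers either, and its constant term is the derivative of the constant terms. -/
theorem deriv_param {F : ℂ → ℂ → ℂ} {e : ℂ → ℂ} {z₀ : ℂ} (hr : 0 ≤ r) (hrR : r < R)
    (hF : ∀ q ∈ ringSet r R, AnalyticAt ℂ (fun x : ℂ × ℂ => F x.1 x.2) (z₀, q))
    (h : ∀ᶠ z in 𝓝 z₀, OuterExtends r R (F z) (e z)) :
    OuterExtends r R (fun p => _root_.deriv (fun z => F z p) z₀) (_root_.deriv e z₀) ∧
      DifferentiableAt ℂ e z₀ := by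
  choose! E hE hFE using fun (z : ℂ) (hz : OuterExtends r R (F z) (e z)) => hz
  -- the same family in the coordinate `w = p⁻¹`, on the ring `R⁻¹ < |w| < r'⁻¹`
  have chart : ∀ r' : ℝ, r < r' → r' < R →
      DifferentiableOn ℂ (fun w => _root_.deriv (fun z => if w = 0 then e z else E z w⁻¹) z₀)
        (Metric.ball 0 r'⁻¹) ∧ ∀ w ∈ Metric.ball (0 : ℂ) r'⁻¹,
          DifferentiableAt ℂ (fun z => if w = 0 then e z else E z w⁻¹) z₀ := by
    intro r' hrr hrR'
    have hr' : 0 < r' := hr.trans_lt hrr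
    have hR : 0 < R := hr'.trans hrR'
    have hring : ∀ q ∈ ringSet R⁻¹ r'⁻¹, q ≠ 0 ∧ q⁻¹ ∈ ringSet r R := by
      intro q hq
      have hq0 : 0 < ‖q‖ := (inv_pos.mpr hR).trans hq.1
      refine ⟨norm_pos_iff.mp hq0, ?_, ?_⟩
      · rw [norm_inv]
        exact hrr.trans (by rw [lt_inv_comm₀ hr' hq0]; exact hq.2)
      · rw [norm_inv, inv_lt_comm₀ hq0 hR]; exact hq.1
    refine differentiableOn_deriv_of_extension (F := fun z w => F z w⁻¹)
      (E := fun z w => if w = 0 then e z else E z w⁻¹)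
      (inv_pos.mpr hR).le (inv_strictAnti₀ hr' hrR') ?_ ?_
    · intro q hq
      refine AnalyticAt.fun_comp (g := fun x : ℂ × ℂ => F x.1 x.2)
        (f := fun x : ℂ × ℂ => (x.1, x.2⁻¹)) (hF _ (hring q hq).2) ?_
      exact analyticAt_fst.prod (analyticAt_snd.inv (hring q hq).1)
    · filter_upwards [h] with z hz
      refine ⟨(hE z hz).differentiableOn_chart hr' hrr.le, fun q hq => ?_⟩
      rw [if_neg (hring q hq).1]
      exact hFE z hz (hring q hq).2
  obtain ⟨r₁, hr₁, hr₁R⟩ := exists_between hrR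
  have hr₁0 : 0 < r₁ := hr.trans_lt hr₁
  refine ⟨⟨fun p => _root_.deriv (fun z => E z p) z₀, ?_, fun p hp => ?_⟩, ?_⟩
  · have h0 := (chart r₁ hr₁ hr₁R).1
    have hcont := (h0.differentiableAt
      (Metric.ball_mem_nhds (0 : ℂ) (inv_pos.mpr hr₁0))).continuousAt
    have key := HolAtInfty.of_chart (r := r) (E := fun p => _root_.deriv (fun z => E z p) z₀) ?_ hr₁0
      hcont (fun w hw _ => by simp only [if_neg hw])
    · simpa using key
    · intro p hp
      obtain ⟨r', hr', hr'2⟩ := exists_between (lt_min hp hrR)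
      have hr'0 : 0 < r' := hr.trans_lt hr'
      have hp0 := ne_zero_of_mem_outerSet hr hp
      have hmem : p⁻¹ ∈ Metric.ball (0 : ℂ) r'⁻¹ := by
        rw [mem_ball_zero_iff, norm_inv]
        exact inv_strictAnti₀ hr'0 (hr'2.trans_le (min_le_left _ _))
      have h1 := ((chart r' hr' (hr'2.trans_le (min_le_right _ _))).1.differentiableAt
        (Metric.isOpen_ball.mem_nhds hmem)).comp p (differentiableAt_inv hp0)
      refine (h1.congr_of_eventuallyEq ?_).differentiableWithinAt
      filter_upwards [isOpen_ne.mem_nhds hp0] with q hq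
      simp only [Function.comp, inv_eq_zero, if_neg hq, inv_inv]
  · refine Filter.EventuallyEq.deriv_eq ?_
    filter_upwards [h] with z hz using hFE z hz hp
  · simpa using (chart r₁ hr₁ hr₁R).2 0 (Metric.mem_ball_self (inv_pos.mpr hr₁0))

end OuterExtends

namespace NegPartVanishes

variable {c : ℂ} {r R : ℝ} {F F' : ℂ → ℂ}

theorem of_differentiableOn (h : DifferentiableOn ℂ F (Metric.ball c R)) :
    NegPartVanishes c r R F := ⟨F, h, fun _ _ _ => rfl⟩

theorem congr (h : NegPartVanishes c r R F)
    (hF : ∀ k, r < ‖k - c‖ → ‖k - c‖ < R → F' k = F k) : NegPartVanishes c r R F' :=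
  let ⟨G, hG, hFG⟩ := h
  ⟨G, hG, fun k h1 h2 => (hF k h1 h2).trans (hFG k h1 h2)⟩

theorem add (h : NegPartVanishes c r R F) (h' : NegPartVanishes c r R F') :
    NegPartVanishes c r R (fun k => F k + F' k) :=
  let ⟨_, hG, hFG⟩ := h
  let ⟨_, hG', hFG'⟩ := h'
  ⟨_, hG.add hG', fun k h1 h2 => by simp only [Pi.add_apply, hFG k h1 h2, hFG' k h1 h2]⟩

theorem sub (h : NegPartVanishes c r R F) (h' : NegPartVanishes c r R F') :
    NegPartVanishes c r R (fun k => F k - F' k) :=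
  let ⟨_, hG, hFG⟩ := h
  let ⟨_, hG', hFG'⟩ := h'
  ⟨_, hG.sub hG', fun k h1 h2 => by simp only [Pi.sub_apply, hFG k h1 h2, hFG' k h1 h2]⟩

theorem mul (h : NegPartVanishes c r R F) (h' : NegPartVanishes c r R F') :
    NegPartVanishes c r R (fun k => F k * F' k) :=
  let ⟨_, hG, hFG⟩ := h
  let ⟨_, hG', hFG'⟩ := h'
  ⟨_, hG.mul hG', fun k h1 h2 => by simp only [Pi.mul_apply, hFG k h1 h2, hFG' k h1 h2]⟩

theorem const (c : ℂ) (r R : ℝ) (a : ℂ) : NegPartVanishes c r R (fun _ => a) :=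
  of_differentiableOn (differentiableOn_const _)

theorem shift (h : NegPartVanishes 0 r R F) (c : ℂ) :
    NegPartVanishes c r R (fun k => F (k - c)) := by
  obtain ⟨G, hG, hFG⟩ := h
  refine ⟨fun k => G (k - c), hG.comp (by fun_prop) fun k hk => ?_, fun k h1 h2 => ?_⟩
  · simpa [dist_eq_norm] using hk
  · exact hFG _ (by simpa using h1) (by simpa using h2)

theorem deriv (h : NegPartVanishes 0 r R F) : NegPartVanishes 0 r R (deriv F) := by
  obtain ⟨G, hG, hFG⟩ := h
  refine ⟨_, hG.deriv Metric.isOpen_ball, fun k h1 h2 => Filter.EventuallyEq.deriv_eq ?_⟩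
  have hk : k ∈ ringSet r R := ⟨by simpa using h1, by simpa using h2⟩
  filter_upwards [(isOpen_ringSet r R).mem_nhds hk] with q hq
  exact hFG q (by simpa using hq.1) (by simpa using hq.2)

/-- The parameter derivative of a holomorphic family of functions without negative powers has no
negative powers either. -/
theorem deriv_param {F : ℂ → ℂ → ℂ} {z₀ : ℂ} (hr : 0 ≤ r) (hrR : r < R)
    (hF : ∀ q ∈ ringSet r R, AnalyticAt ℂ (fun x : ℂ × ℂ => F x.1 x.2) (z₀, q))
    (h : ∀ᶠ z in 𝓝 z₀, NegPartVanishes 0 r R (F z)) :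
    NegPartVanishes 0 r R (fun p => _root_.deriv (fun z => F z p) z₀) := by
  choose! G hG hFG using fun (z : ℂ) (hz : NegPartVanishes 0 r R (F z)) => hz
  refine ⟨_, (differentiableOn_deriv_of_extension (E := G) hr hrR hF ?_).1, fun k h1 h2 => ?_⟩
  · filter_upwards [h] with z hz
    exact ⟨hG z hz, fun q hq => hFG z hz q (by simpa using hq.1) (by simpa using hq.2)⟩
  · refine Filter.EventuallyEq.deriv_eq ?_
    filter_upwards [h] with z hz using hFG z hz k h1 h2

end NegPartVanishes

/-- A function on the annulus that has neither negative nor positive powers is constant. -/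
theorem OuterExtends.eq_of_negPartVanishes {r R : ℝ} {F : ℂ → ℂ} {e : ℂ} (hrR : r < R)
    (h : OuterExtends r R F e) (h' : NegPartVanishes 0 r R F) : ∀ p ∈ ringSet r R, F p = e := by
  classical
  obtain ⟨E, hE, hFE⟩ := h
  obtain ⟨G, hG, hFG⟩ := h'
  set H : ℂ → ℂ := fun p => if ‖p‖ < R then G p else E p with hH
  have hHG : ∀ p : ℂ, ‖p‖ < R → H p = G p := fun p hp => if_pos hp
  have hHE : ∀ p : ℂ, r < ‖p‖ → H p = E p := by
    intro p hp
    by_cases hpR : ‖p‖ < R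
    · rw [hHG p hpR, ← hFE ⟨hp, hpR⟩]
      exact (hFG p (by simpa using hp) (by simpa using hpR)).symm
    · exact if_neg hpR
  have hd : Differentiable ℂ H := by
    intro p
    by_cases hpR : ‖p‖ < R
    · have hm : Metric.ball (0 : ℂ) R ∈ 𝓝 p := Metric.isOpen_ball.mem_nhds (by simpa using hpR)
      refine (hG.differentiableAt hm).congr_of_eventuallyEq ?_
      filter_upwards [hm] with q hq using hHG q (by simpa using hq)
    · have hm : outerSet r ∈ 𝓝 p :=
        (isOpen_outerSet r).mem_nhds (hrR.trans_le (not_lt.mp hpR))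
      refine (hE.diff.differentiableAt hm).congr_of_eventuallyEq ?_
      filter_upwards [hm] with q hq using hHE q hq
  have hlim : Tendsto H (cocompact ℂ) (𝓝 e) := by
    rw [← Metric.cobounded_eq_cocompact]
    refine hE.lim.congr' ?_
    filter_upwards [eventually_cobounded_mem_outerSet r] with q hq using (hHE q hq).symm
  intro p hp
  rw [hFE hp, ← hHE p hp.1]
  exact hd.apply_eq_of_tendsto_cocompact p hlim

theorem OuterExtends.unique {r R : ℝ} {F : ℂ → ℂ} {e e' : ℂ} (hr : 0 ≤ r) (hrR : r < R)
    (h : OuterExtends r R F e) (h' : OuterExtends r R F e') : e = e' := by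
  have h1 := (h.sub h').congr (F' := fun _ => (0 : ℂ)) fun p _ => (sub_self _).symm
  obtain ⟨p, hp⟩ := ringSet_nonempty hr hrR
  exact sub_eq_zero.mp
    (h1.eq_of_negPartVanishes hrR (NegPartVanishes.const 0 r R 0) p hp).symm

theorem eqOn_outerSet_of_eqOn_ringSet {r R : ℝ} (hr : 0 ≤ r) (hrR : r < R) {F G : ℂ → ℂ}
    (hF : DifferentiableOn ℂ F (outerSet r)) (hG : DifferentiableOn ℂ G (outerSet r))
    (h : Set.EqOn F G (ringSet r R)) : Set.EqOn F G (outerSet r) := by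
  obtain ⟨p, hp⟩ := ringSet_nonempty hr hrR
  refine (hF.analyticOnNhd (isOpen_outerSet r)).eqOn_of_preconnected_of_eventuallyEq
    (hG.analyticOnNhd (isOpen_outerSet r)) (isPreconnected_outerSet hr)
    (ringSet_subset_outerSet r R hp) ?_
  filter_upwards [(isOpen_ringSet r R).mem_nhds hp] with q hq using h hq

/-! ### Convergent series -/

theorem differentiableOn_tsum_mul_pow {ι : Type*} {β : ι → ℂ} {k : ι → ℕ} {l : ℂ}
    (hs : Summable fun i => β i * l ^ k i) :
    DifferentiableOn ℂ (fun x : ℂ => ∑' i, β i * x ^ k i) (Metric.ball 0 ‖l‖) := by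
  refine Complex.differentiableOn_tsum_of_summable_norm hs.norm (fun i => by fun_prop)
    Metric.isOpen_ball fun i w hw => ?_
  have hw' : ‖w‖ < ‖l‖ := by simpa using hw
  rw [norm_mul, norm_mul, norm_pow, norm_pow]
  gcongr

theorem differentiableOn_tsum_mul_pow_of_forall {a : ℕ → ℂ} {b : ℝ}
    (hs : ∀ q : ℂ, 0 < ‖q‖ → ‖q‖ < b → Summable fun n => a n * q ^ n) :
    DifferentiableOn ℂ (fun x : ℂ => ∑' n, a n * x ^ n) (Metric.ball 0 b) := by
  intro q hq
  have hq' : ‖q‖ < b := by simpa using hq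
  obtain ⟨ρ, h1, h2⟩ := exists_between hq'
  have hρ : 0 < ρ := (norm_nonneg q).trans_lt h1
  have hn : ‖(ρ : ℂ)‖ = ρ := by rw [Complex.norm_real, Real.norm_of_nonneg hρ.le]
  have hd := differentiableOn_tsum_mul_pow (hs ρ (by rwa [hn]) (by rwa [hn]))
  exact (hd.differentiableAt (Metric.isOpen_ball.mem_nhds
    (by rw [hn]; simpa using h1))).differentiableWithinAt

theorem HolAtInfty.of_hasSum {r : ℝ} (hr : 0 ≤ r) {a : ℕ → ℂ} {E : ℂ → ℂ}
    (hE : DifferentiableOn ℂ E (outerSet r))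
    (hs : ∀ p ∈ outerSet r, HasSum (fun n : ℕ => a n * (p ^ n)⁻¹) (E p)) :
    HolAtInfty r E (a 0) := by
  have hr' : 0 < r + 1 := by linarith
  have hmem : ∀ q : ℂ, 0 < ‖q‖ → ‖q‖ < (r + 1)⁻¹ → q⁻¹ ∈ outerSet r := by
    intro q h0 h1
    show r < ‖q⁻¹‖
    rw [norm_inv]
    have : r + 1 < ‖q‖⁻¹ := by rwa [lt_inv_comm₀ hr' h0]
    linarith
  have hsum : ∀ q : ℂ, 0 < ‖q‖ → ‖q‖ < (r + 1)⁻¹ → HasSum (fun n => a n * q ^ n) (E q⁻¹) := by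
    intro q h0 h1
    simpa using hs _ (hmem q h0 h1)
  have hd := differentiableOn_tsum_mul_pow_of_forall fun q h0 h1 => (hsum q h0 h1).summable
  have h0 : (∑' n, a n * (0 : ℂ) ^ n) = a 0 := by
    rw [tsum_eq_single 0 (fun n hn => by simp [hn])]
    simp
  have key := HolAtInfty.of_chart (A := fun x => ∑' n, a n * x ^ n) hE hr'
    (hd.differentiableAt (Metric.ball_mem_nhds 0 (inv_pos.mpr hr'))).continuousAt
    (fun w hw hwr => (hsum w (norm_pos_iff.mpr hw) hwr).tsum_eq.symm)
  simpa only [h0] using key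

theorem HolAtInfty.exists_hasSum {r : ℝ} (hr : 0 ≤ r) {E : ℂ → ℂ} (h : HolAtInfty r E 0) :
    ∃ a : ℕ+ → ℂ, ∀ᶠ k in Bornology.cobounded ℂ,
      HasSum (fun n : ℕ+ => a n * (k ^ (n : ℕ))⁻¹) (E k) := by
  have hr' : 0 < r + 1 := by linarith
  have hd := h.differentiableOn_chart hr' (by linarith)
  set A : ℂ → ℂ := fun w => if w = 0 then 0 else E w⁻¹ with hA
  refine ⟨fun n => ((Nat.factorial n : ℕ) : ℂ)⁻¹ * iteratedDeriv n A 0, ?_⟩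
  filter_upwards [eventually_cobounded_mem_outerSet (r + 1)] with k hk
  have hk' : r + 1 < ‖k‖ := hk
  have hk0 : k ≠ 0 := norm_pos_iff.mp (hr'.trans hk')
  have h1 := Complex.hasSum_taylorSeries_on_ball hd (z := k⁻¹) (by
    rw [mem_ball_zero_iff, norm_inv]
    exact inv_strictAnti₀ hr' hk')
  have h2 : A k⁻¹ = E k := by simp [hA, hk0]
  rw [h2, ← hasSum_nat_add_iff' 1] at h1
  have h3 : A 0 = 0 := by simp [hA]
  simp only [Finset.range_one, Finset.sum_singleton, iteratedDeriv_zero, h3, smul_zero,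
    sub_zero] at h1
  rw [← Equiv.pnatEquivNat.symm.hasSum_iff]
  have h4 : ((fun n : ℕ+ => ((Nat.factorial n : ℕ) : ℂ)⁻¹ * iteratedDeriv n A 0 * (k ^ (n : ℕ))⁻¹)
      ∘ Equiv.pnatEquivNat.symm) = fun n : ℕ => ((Nat.factorial (n + 1) : ℕ) : ℂ)⁻¹ •
        k⁻¹ ^ (n + 1) • iteratedDeriv (n + 1) A 0 := by
    funext n
    show ((Nat.factorial (n + 1) : ℕ) : ℂ)⁻¹ * iteratedDeriv (n + 1) A 0 * (k ^ (n + 1))⁻¹ = _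
    simp only [smul_eq_mul, inv_pow]
    ring
  rw [h4]
  exact h1

section SeriesAtZero

variable {c : ℂ} {a : ℕ → ℂ} {b : ℝ} {h : ℂ → ℂ}

/-- If `1 / h = c / q + ∑ aₙ qⁿ` with `c ≠ 0` does not vanish for `0 < |q| < b`, then `h` has a
simple zero at the origin and no other zero. -/
theorem exists_eq_div_of_hasSum (hc : c ≠ 0) (hh : ∀ q : ℂ, 0 < ‖q‖ → ‖q‖ < b → h q ≠ 0)
    (hs : ∀ q : ℂ, 0 < ‖q‖ → ‖q‖ < b →
      HasSum (fun n : ℕ => a n * q ^ n) ((h q)⁻¹ - c * q⁻¹)) :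
    ∃ A : ℂ → ℂ, DifferentiableOn ℂ A (Metric.ball 0 b) ∧
      (∀ q ∈ Metric.ball (0 : ℂ) b, A q ≠ 0) ∧
      ∀ q : ℂ, 0 < ‖q‖ → ‖q‖ < b → h q = q / A q := by
  have hd := differentiableOn_tsum_mul_pow_of_forall fun q h0 h1 => (hs q h0 h1).summable
  have hA : ∀ q : ℂ, 0 < ‖q‖ → ‖q‖ < b → c + q * ∑' n, a n * q ^ n = q * (h q)⁻¹ := by
    intro q h0 h1
    have : q ≠ 0 := norm_pos_iff.mp h0
    rw [(hs q h0 h1).tsum_eq]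
    field_simp
    ring
  refine ⟨fun q => c + q * ∑' n, a n * q ^ n, (differentiableOn_id.mul hd).const_add c,
    fun q hq => ?_, fun q h0 h1 => ?_⟩
  · rcases eq_or_ne q 0 with rfl | h0
    · simpa using hc
    · have h0' := norm_pos_iff.mpr h0
      have hq' : ‖q‖ < b := by simpa using hq
      simp only
      rw [hA q h0' hq']
      exact mul_ne_zero h0 (inv_ne_zero (hh q h0' hq'))
  · have h2 : q ≠ 0 := norm_pos_iff.mp h0
    have h3 := hh q h0 h1
    simp only
    rw [hA q h0 h1]
    field_simp

/-- If `∑ βₙ h(q)ⁿ` converges for `0 < |q| < b`, where `h` is as in the preceding lemma, then it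
is `h` times a holomorphic function on the disc. By the maximum principle, `|h|` takes values larger
than any given one, so that the radius of convergence of `∑ βₙ λⁿ` exceeds every `|h(q)|`. -/
theorem exists_tsum_eq_mul_of_summable (hb : 0 < b) {A : ℂ → ℂ}
    (hA : DifferentiableOn ℂ A (Metric.ball 0 b)) (hA0 : ∀ q ∈ Metric.ball (0 : ℂ) b, A q ≠ 0)
    (hhA : ∀ q : ℂ, 0 < ‖q‖ → ‖q‖ < b → h q = q / A q) {β : ℕ+ → ℂ}
    (hβ : ∀ q : ℂ, 0 < ‖q‖ → ‖q‖ < b → Summable fun n : ℕ+ => β n * h q ^ (n : ℕ)) :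
    ∃ Φ : ℂ → ℂ, DifferentiableOn ℂ Φ (Metric.ball 0 b) ∧
      ∀ q : ℂ, 0 < ‖q‖ → ‖q‖ < b → ∑' n : ℕ+, β n * h q ^ (n : ℕ) = h q * Φ q := by
  have hpow : ∀ (n : ℕ+) (x : ℂ), x ^ (n : ℕ) = x * x ^ ((n : ℕ) - 1) := fun n x => by
    rw [← pow_succ', Nat.sub_add_cancel n.pos]
  have hd : DifferentiableOn ℂ (fun q => q / A q) (Metric.ball 0 b) := differentiableOn_id.div hA hA0
  have hlarge : ∀ q ∈ Metric.ball (0 : ℂ) b, ∃ q₁ ∈ Metric.ball (0 : ℂ) b,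
      ‖q / A q‖ < ‖q₁ / A q₁‖ := by
    intro q hq
    by_contra hcon
    push Not at hcon
    have heq := Complex.eqOn_of_isPreconnected_of_isMaxOn_norm
      (convex_ball (0 : ℂ) b).isPreconnected Metric.isOpen_ball hd hq (fun x hx => hcon x hx)
    have h0 : (0 : ℂ) = q / A q := by simpa using heq (Metric.mem_ball_self hb)
    have hn : ‖((b / 2 : ℝ) : ℂ)‖ = b / 2 := by
      rw [Complex.norm_real, Real.norm_of_nonneg (by linarith)]
    have hm : ((b / 2 : ℝ) : ℂ) ∈ Metric.ball (0 : ℂ) b := by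
      rw [mem_ball_zero_iff, hn]; linarith
    have h1 := heq hm
    simp only [Function.const, ← h0] at h1
    refine div_ne_zero (norm_pos_iff.mp ?_) (hA0 _ hm) h1
    rw [hn]; linarith
  refine ⟨fun q => ∑' n : ℕ+, β n * (q / A q) ^ ((n : ℕ) - 1), fun q hq => ?_, fun q h0 h1 => ?_⟩
  · obtain ⟨q₁, hq₁, hlt⟩ := hlarge q hq
    have hne : q₁ / A q₁ ≠ 0 := norm_pos_iff.mp ((norm_nonneg _).trans_lt hlt)
    have hq₁0 : 0 < ‖q₁‖ := norm_pos_iff.mpr fun h => hne (by simp [h])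
    have hq₁b : ‖q₁‖ < b := by simpa using hq₁
    have hs := hβ q₁ hq₁0 hq₁b
    rw [hhA q₁ hq₁0 hq₁b] at hs
    have hs' : Summable fun n : ℕ+ => β n * (q₁ / A q₁) ^ ((n : ℕ) - 1) := by
      refine (hs.mul_left (q₁ / A q₁)⁻¹).congr fun n => ?_
      rw [hpow n, mul_left_comm, inv_mul_cancel_left₀ hne]
    have h1 := (differentiableOn_tsum_mul_pow hs').differentiableAt
      (Metric.isOpen_ball.mem_nhds (mem_ball_zero_iff.mpr hlt))
    exact (DifferentiableAt.comp (f := fun q => q / A q)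
      (g := fun x => ∑' n : ℕ+, β n * x ^ ((n : ℕ) - 1)) q h1
      (hd.differentiableAt (Metric.isOpen_ball.mem_nhds hq))).differentiableWithinAt
  · simp only
    rw [hhA q h0 h1, ← tsum_mul_left]
    refine tsum_congr fun n => ?_
    rw [hpow n]
    ring

end SeriesAtZero

/-- If `∑ βₙ L(p)ⁿ` converges on the annulus, where `L = p + O(1)` at infinity, then `∑ βₙ λⁿ` is
holomorphic at the values of `L` there. -/
theorem analyticAt_tsum_of_summable {r R : ℝ} (hr : 0 ≤ r) {L : ℂ → ℂ} {u : ℂ}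
    (hL : HolAtInfty r (fun p => L p - p) u) {β : ℕ+ → ℂ}
    (hβ : ∀ p ∈ ringSet r R, Summable fun n : ℕ+ => β n * L p ^ (n : ℕ)) {p : ℂ}
    (hp : p ∈ ringSet r R) :
    AnalyticAt ℂ (fun l => ∑' n : ℕ+, β n * l ^ (n : ℕ)) (L p) := by
  have hLd : DifferentiableOn ℂ L (outerSet r) :=
    (hL.diff.add differentiableOn_id).congr fun q _ => by simp
  have hlarge : ∃ q ∈ ringSet r R, ‖L p‖ < ‖L q‖ := by
    by_contra hcon
    push Not at hcon
    have hnhds := (isOpen_ringSet r R).mem_nhds hp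
    have hev := Complex.eventually_eq_of_isLocalMax_norm (f := L) (c := p)
      (by filter_upwards [hnhds] with q hq using hLd.differentiableAt
            ((isOpen_outerSet r).mem_nhds hq.1))
      (by filter_upwards [hnhds] with q hq using hcon q hq)
    have hconst := (hLd.analyticOnNhd (isOpen_outerSet r)).eqOn_of_preconnected_of_eventuallyEq
      (g := fun _ => L p) (fun _ _ => analyticAt_const) (isPreconnected_outerSet hr) hp.1 hev
    have h1 : Tendsto (fun q : ℂ => q) (Bornology.cobounded ℂ) (𝓝 (L p - u)) := by
      refine ((tendsto_const_nhds (x := L p)).sub hL.lim).congr' ?_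
      filter_upwards [eventually_cobounded_mem_outerSet r] with q hq
      rw [hconst hq]
      ring
    exact not_tendsto_nhds_of_tendsto_atTop (tendsto_norm_cobounded_atTop (E := ℂ)) _ h1.norm
  obtain ⟨q, hq, hlt⟩ := hlarge
  exact (differentiableOn_tsum_mul_pow (hβ q hq)).analyticAt
    (Metric.isOpen_ball.mem_nhds (mem_ball_zero_iff.mpr hlt))

/-- The tail `∑ vₙ L⁻ⁿ` is holomorphic outside the inner circle and vanishes at infinity. -/
theorem holAtInfty_tsum_inv {r : ℝ} (hr : 0 ≤ r) {L : ℂ → ℂ} {a : ℕ → ℂ} {v : ℕ+ → ℂ}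
    (hL0 : ∀ p ∈ outerSet r, L p ≠ 0)
    (hs : ∀ p ∈ outerSet r, HasSum (fun n : ℕ => a n * (p ^ n)⁻¹) (L p - p))
    (hv : ∀ p ∈ outerSet r, Summable fun n : ℕ+ => v n * (L p ^ (n : ℕ))⁻¹) :
    HolAtInfty r (fun p => ∑' n : ℕ+, v n * (L p ^ (n : ℕ))⁻¹) 0 := by
  have chart : ∀ r' : ℝ, r ≤ r' → 0 < r' → ∃ T : ℂ → ℂ, DifferentiableOn ℂ T (Metric.ball 0 r'⁻¹) ∧
      T 0 = 0 ∧ ∀ w : ℂ, 0 < ‖w‖ → ‖w‖ < r'⁻¹ →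
        ∑' n : ℕ+, v n * (L w⁻¹ ^ (n : ℕ))⁻¹ = T w := by
    intro r' hrr hr'
    have hmem : ∀ q : ℂ, 0 < ‖q‖ → ‖q‖ < r'⁻¹ → q⁻¹ ∈ outerSet r := by
      intro q h0 h1
      show r < ‖q⁻¹‖
      rw [norm_inv]
      exact hrr.trans_lt (by rwa [lt_inv_comm₀ hr' h0])
    obtain ⟨A, hA, hA0, hhA⟩ := exists_eq_div_of_hasSum (h := fun w => (L w⁻¹)⁻¹) (c := 1)
      (a := a) (b := r'⁻¹) one_ne_zero (fun q h0 h1 => inv_ne_zero (hL0 _ (hmem q h0 h1)))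
      (fun q h0 h1 => by simpa using hs _ (hmem q h0 h1))
    obtain ⟨Φ, hΦ, hΦe⟩ := exists_tsum_eq_mul_of_summable (inv_pos.mpr hr') hA hA0 hhA (β := v)
      (fun q h0 h1 => by simpa using hv _ (hmem q h0 h1))
    refine ⟨fun w => w / A w * Φ w, (differentiableOn_id.div hA hA0).mul hΦ, by simp, ?_⟩
    intro w h0 h1
    have := hΦe w h0 h1
    simp only [inv_pow] at this
    rw [this, hhA w h0 h1]
  have hdiff : DifferentiableOn ℂ (fun p => ∑' n : ℕ+, v n * (L p ^ (n : ℕ))⁻¹) (outerSet r) := by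
    intro p hp
    obtain ⟨r', h1, h2⟩ := exists_between (show r < ‖p‖ from hp)
    have hr' : 0 < r' := hr.trans_lt h1
    have hp0 := ne_zero_of_mem_outerSet hr hp
    obtain ⟨T, hT, -, hTe⟩ := chart r' h1.le hr'
    have hmem : p⁻¹ ∈ Metric.ball (0 : ℂ) r'⁻¹ := by
      rw [mem_ball_zero_iff, norm_inv]
      exact inv_strictAnti₀ hr' h2
    have h3 := (hT.differentiableAt (Metric.isOpen_ball.mem_nhds hmem)).comp p
      (differentiableAt_inv hp0)
    refine (h3.congr_of_eventuallyEq ?_).differentiableWithinAt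
    filter_upwards [(isOpen_outerSet r').mem_nhds h2] with q hq
    have hq' : r' < ‖q‖ := hq
    have hq0 : 0 < ‖q‖ := hr'.trans hq'
    have := hTe q⁻¹ (by rw [norm_inv]; exact inv_pos.mpr hq0)
      (by rw [norm_inv]; exact inv_strictAnti₀ hr' hq')
    simpa using this
  have hr' : 0 < r + 1 := by linarith
  obtain ⟨T, hT, hT0, hTe⟩ := chart (r + 1) (by linarith) hr'
  have key := HolAtInfty.of_chart (A := T) hdiff hr'
    (hT.differentiableAt (Metric.ball_mem_nhds 0 (inv_pos.mpr hr'))).continuousAt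
    (fun w hw hwr => hTe w (norm_pos_iff.mpr hw) hwr)
  rwa [hT0] at key

noncomputable section

/-! ### Functions of the Toda variables at `t̄ = 0` -/

/-- The parameters `(t, s)`, for functions taken at `t̄ = 0`. -/
abbrev TodaPoint : Type := Times × ℂ

/-- The point `θ` with one coordinate replaced by `z`: `tₙ` for the direction `some n`, and `s`
for the direction `none`. -/
def move : Option ℕ+ → TodaPoint → ℂ → TodaPoint
  | none, θ, z => (θ.1, z)
  | some n, θ, z => (Function.update θ.1 n z, θ.2)

/-- The coordinate of `θ` that belongs to a direction. -/
def coord : Option ℕ+ → TodaPoint → ℂ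
  | none, θ => θ.2
  | some n, θ => θ.1 n

@[simp] theorem move_coord (d : Option ℕ+) (θ : TodaPoint) : move d θ (coord d θ) = θ := by
  cases d <;> simp [move, coord]

@[simp] theorem coord_move (d : Option ℕ+) (θ : TodaPoint) (z : ℂ) : coord d (move d θ z) = z := by
  cases d <;> simp [move, coord]

@[simp] theorem move_move (d : Option ℕ+) (θ : TodaPoint) (z w : ℂ) :
    move d (move d θ z) w = move d θ w := by
  cases d <;> simp [move]

/-- A set of parameters that is open in each direction. -/
def DirOpen (Ω : Set TodaPoint) : Prop :=
  ∀ θ ∈ Ω, ∀ d, ∀ᶠ z in 𝓝 (coord d θ), move d θ z ∈ Ω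

/-- A function of the parameters is holomorphic in each direction. -/
def ParamHol (e : TodaPoint → ℂ) (θ : TodaPoint) : Prop :=
  ∀ d, AnalyticAt ℂ (fun z => e (move d θ z)) (coord d θ)

/-- `F(θ, p)` is holomorphic in `p` jointly with any one of the parameters. -/
def JointHol (F : TodaPoint → ℂ → ℂ) (θ : TodaPoint) (p : ℂ) : Prop :=
  ∀ d, AnalyticAt ℂ (fun x : ℂ × ℂ => F (move d θ x.1) x.2) (coord d θ, p)

/-- The partial derivative of a function of the parameters. -/
def pderiv (d : Option ℕ+) (e : TodaPoint → ℂ) (θ : TodaPoint) : ℂ :=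
  deriv (fun z => e (move d θ z)) (coord d θ)

theorem ParamHol.hasDerivAt {e : TodaPoint → ℂ} {θ : TodaPoint} (h : ParamHol e θ)
    (d : Option ℕ+) : HasDerivAt (fun z => e (move d θ z)) (pderiv d e θ) (coord d θ) :=
  (h d).differentiableAt.hasDerivAt

theorem ParamHol.jointHol {e : TodaPoint → ℂ} {θ : TodaPoint} (h : ParamHol e θ) (p : ℂ) :
    JointHol (fun θ _ => e θ) θ p := fun d =>
  AnalyticAt.fun_comp (g := fun z => e (move d θ z)) (f := fun x : ℂ × ℂ => x.1) (h d)
    analyticAt_fst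

namespace JointHol

variable {F G : TodaPoint → ℂ → ℂ} {θ : TodaPoint} {p : ℂ}

theorem sub (hF : JointHol F θ p) (hG : JointHol G θ p) :
    JointHol (fun θ p => F θ p - G θ p) θ p := fun d => (hF d).sub (hG d)

theorem mul (hF : JointHol F θ p) (hG : JointHol G θ p) :
    JointHol (fun θ p => F θ p * G θ p) θ p := fun d => (hF d).mul (hG d)

theorem pow (hF : JointHol F θ p) (n : ℕ) :
    JointHol (fun θ p => F θ p ^ n) θ p := fun d => (hF d).pow n

theorem inv (hF : JointHol F θ p) (h0 : F θ p ≠ 0) :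
    JointHol (fun θ p => (F θ p)⁻¹) θ p := fun d => (hF d).inv (by simpa using h0)

theorem id (θ : TodaPoint) (p : ℂ) : JointHol (fun _ p => p) θ p := fun _ => analyticAt_snd

theorem sum {ι : Type*} {F : ι → TodaPoint → ℂ → ℂ} (s : Finset ι)
    (hF : ∀ i ∈ s, JointHol (F i) θ p) : JointHol (fun θ p => ∑ i ∈ s, F i θ p) θ p := fun d =>
  Finset.analyticAt_fun_sum s fun i hi => hF i hi d

theorem hasDerivAt (hF : JointHol F θ p) (d : Option ℕ+) :
    HasDerivAt (fun z => F (move d θ z) p) (pderiv d (fun θ => F θ p) θ) (coord d θ) :=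
  (AnalyticAt.curry_fst' (F := fun z q => F (move d θ z) q) (hF d)).differentiableAt.hasDerivAt

theorem analyticAt (hF : JointHol F θ p) : AnalyticAt ℂ (F θ) p := by
  simpa using AnalyticAt.curry_snd' (F := fun z q => F (move none θ z) q) (hF none)

theorem hasDerivAt_snd (hF : JointHol F θ p) : HasDerivAt (F θ) (deriv (F θ) p) p :=
  hF.analyticAt.differentiableAt.hasDerivAt

theorem analyticAt_pderiv (hF : JointHol F θ p) (d : Option ℕ+) :
    AnalyticAt ℂ (fun q => pderiv d (fun θ => F θ q) θ) p :=
  AnalyticAt.curry_snd' (F := fun a b => deriv (fun z => F (move d θ z) b) a) (hF d).deriv_fst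

end JointHol

section Families

variable {r R : ℝ} {Ω : Set TodaPoint} {F : TodaPoint → ℂ → ℂ} {e : TodaPoint → ℂ}
  {θ : TodaPoint}

theorem NegPartVanishes.pderiv (hr : 0 ≤ r) (hrR : r < R) (hΩ : DirOpen Ω)
    (hF : ∀ θ ∈ Ω, ∀ p ∈ ringSet r R, JointHol F θ p)
    (h : ∀ θ ∈ Ω, NegPartVanishes 0 r R (F θ)) (hθ : θ ∈ Ω) (d : Option ℕ+) :
    NegPartVanishes 0 r R (fun p => pderiv d (fun θ => F θ p) θ) :=
  NegPartVanishes.deriv_param (F := fun z p => F (move d θ z) p) hr hrR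
    (fun q hq => hF θ hθ q hq d) ((hΩ θ hθ d).mono fun _ hz => h _ hz)

theorem OuterExtends.pderiv (hr : 0 ≤ r) (hrR : r < R) (hΩ : DirOpen Ω)
    (hF : ∀ θ ∈ Ω, ∀ p ∈ ringSet r R, JointHol F θ p)
    (h : ∀ θ ∈ Ω, OuterExtends r R (F θ) (e θ)) (hθ : θ ∈ Ω) (d : Option ℕ+) :
    OuterExtends r R (fun p => pderiv d (fun θ => F θ p) θ) (pderiv d e θ) :=
  (OuterExtends.deriv_param (F := fun z p => F (move d θ z) p) hr hrR
    (fun q hq => hF θ hθ q hq d) ((hΩ θ hθ d).mono fun _ hz => h _ hz)).1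

theorem OuterExtends.paramHol (hr : 0 ≤ r) (hrR : r < R) (hΩ : DirOpen Ω)
    (hF : ∀ θ ∈ Ω, ∀ p ∈ ringSet r R, JointHol F θ p)
    (h : ∀ θ ∈ Ω, OuterExtends r R (F θ) (e θ)) (hθ : θ ∈ Ω) : ParamHol e θ := by
  have hd : ∀ θ ∈ Ω, ∀ d, DifferentiableAt ℂ (fun z => e (move d θ z)) (coord d θ) :=
    fun θ hθ d => (OuterExtends.deriv_param (F := fun z p => F (move d θ z) p) hr hrR
      (fun q hq => hF θ hθ q hq d) ((hΩ θ hθ d).mono fun _ hz => h _ hz)).2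
  intro d
  rw [Complex.analyticAt_iff_eventually_differentiableAt]
  filter_upwards [hΩ θ hθ d] with z hz
  simpa using hd _ hz d

end Families

/-! ### Expansions of the Toda quadruple -/

theorem tsum_update_time {t : Times} {n : ℕ+} {z x : ℂ}
    (hs : Summable fun m : ℕ+ => (m : ℂ) * Function.update t n z m * x ^ (m : ℕ)) :
    ∑' m : ℕ+, (m : ℂ) * Function.update t n z m * x ^ (m : ℕ)
      = ∑' m : ℕ+, (m : ℂ) * t m * x ^ (m : ℕ) + (n : ℂ) * (z - t n) * x ^ (n : ℕ) := by
  have h1 := hs.hasSum.update n ((n : ℂ) * t n * x ^ (n : ℕ))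
  have h2 : Function.update (fun m : ℕ+ => (m : ℂ) * Function.update t n z m * x ^ (m : ℕ)) n
      ((n : ℂ) * t n * x ^ (n : ℕ)) = fun m : ℕ+ => (m : ℂ) * t m * x ^ (m : ℕ) := by
    funext m
    by_cases hm : m = n
    · subst hm; simp
    · simp [hm]
  rw [h2] at h1
  rw [h1.tsum_eq]
  simp only [Function.update_self]
  ring

theorem hasDerivAt_comp₂ {f : ℂ → ℂ → ℂ} {l m : ℂ → ℂ} {z l' m' : ℂ}
    (hf : DifferentiableAt ℂ (fun x : ℂ × ℂ => f x.1 x.2) (l z, m z))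
    (hl : HasDerivAt l l' z) (hm : HasDerivAt m m' z) :
    HasDerivAt (fun w => f (l w) (m w))
      (deriv (fun a => f a (m z)) (l z) * l' + deriv (fun b => f (l z) b) (m z) * m') z := by
  have hfd := hf.hasFDerivAt
  have h1 := hfd.comp_hasDerivAt z (hl.prodMk hm)
  have h2 := (hfd.comp_hasDerivAt (f := fun a : ℂ => (a, m z)) (l z)
    ((hasDerivAt_id (l z)).prodMk (hasDerivAt_const _ _))).deriv
  have h3 := (hfd.comp_hasDerivAt (f := fun b : ℂ => (l z, b)) (m z)
    ((hasDerivAt_const _ _).prodMk (hasDerivAt_id (m z)))).deriv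
  simp only [Function.comp_def] at h1 h2 h3
  refine h1.congr_deriv ?_
  rw [h2, h3]
  have : ((l', m') : ℂ × ℂ) = l' • ((1 : ℂ), (0 : ℂ)) + m' • ((0 : ℂ), (1 : ℂ)) := by simp
  rw [this, map_add, map_smul, map_smul, smul_eq_mul, smul_eq_mul]
  ring

namespace DTodaQuadruple

variable (S : DTodaQuadruple)

/-- The parameters `(t, s)` with `(t, 0, s)` in the domain. -/
def slice : Set TodaPoint := {θ | (θ.1, 0, θ.2) ∈ S.dom}

/-- `L` at `t̄ = 0`. -/
def L₀ (θ : TodaPoint) (p : ℂ) : ℂ := S.L θ.1 0 θ.2 p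

/-- `M` at `t̄ = 0`. -/
def M₀ (θ : TodaPoint) (p : ℂ) : ℂ := S.M θ.1 0 θ.2 p

/-- `L̄` at `t̄ = 0`. -/
def Lb₀ (θ : TodaPoint) (p : ℂ) : ℂ := S.Lb θ.1 0 θ.2 p

/-- `M̄` at `t̄ = 0`. -/
def Mb₀ (θ : TodaPoint) (p : ℂ) : ℂ := S.Mb θ.1 0 θ.2 p

/-- `u₀` at `t̄ = 0`. -/
def u₀ (θ : TodaPoint) : ℂ := S.u 0 θ.1 0 θ.2

/-- The tail `∑ vₙ L⁻ⁿ` of `M` at `t̄ = 0`, written as the difference between `M` and the other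
terms; the holomorphy of `M` in the parameters then carries over to it. -/
def tail (θ : TodaPoint) (p : ℂ) : ℂ :=
  S.M₀ θ p - ∑' n : ℕ+, (n : ℂ) * θ.1 n * S.L₀ θ p ^ (n : ℕ) - θ.2

/-- The derivative of `∑ n tₙ λⁿ + s` in a direction, at fixed `λ`. -/
def explicitDeriv : Option ℕ+ → ℂ → ℂ
  | none, _ => 1
  | some n, l => (n : ℂ) * l ^ (n : ℕ)

variable {S}

section Form

variable (h : S.HasForm)
include h

theorem HasForm.dirOpen : DirOpen S.slice := by
  intro θ hθ d
  cases d with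
  | none => exact (h.dom_open _ _ _ hθ).2.2
  | some n => exact (h.dom_open _ _ _ hθ).1 n

variable {θ : TodaPoint} (hθ : θ ∈ S.slice) {p : ℂ}
include hθ

theorem HasForm.jointHol_L (hp : p ∈ outerSet S.r) : JointHol S.L₀ θ p := by
  rintro (_ | n)
  · exact (h.L_hol _ _ _ hθ p hp).2.2
  · exact (h.L_hol _ _ _ hθ p hp).1 n

theorem HasForm.jointHol_M (hp : p ∈ ringSet S.r S.R) : JointHol S.M₀ θ p := by
  rintro (_ | n)
  · exact (h.M_hol _ _ _ hθ p hp.1 hp.2).2.2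
  · exact (h.M_hol _ _ _ hθ p hp.1 hp.2).1 n

theorem HasForm.jointHol_Lb (hp : p ∈ ringSet S.r S.R) : JointHol S.Lb₀ θ p := by
  have h0 := h.r_nonneg.trans_lt hp.1
  rintro (_ | n)
  · exact (h.Lb_hol _ _ _ hθ p h0 hp.2).2.2
  · exact (h.Lb_hol _ _ _ hθ p h0 hp.2).1 n

theorem HasForm.jointHol_Mb (hp : p ∈ ringSet S.r S.R) : JointHol S.Mb₀ θ p := by
  rintro (_ | n)
  · exact (h.Mb_hol _ _ _ hθ p hp.1 hp.2).2.2
  · exact (h.Mb_hol _ _ _ hθ p hp.1 hp.2).1 n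

theorem HasForm.L₀_ne_zero (hp : p ∈ outerSet S.r) : S.L₀ θ p ≠ 0 := h.L_ne _ _ _ hθ p hp

theorem HasForm.Lb₀_ne_zero (hp : p ∈ ringSet S.r S.R) : S.Lb₀ θ p ≠ 0 :=
  h.Lb_ne _ _ _ hθ p (h.r_nonneg.trans_lt hp.1) hp.2

theorem HasForm.differentiableOn_L : DifferentiableOn ℂ (S.L₀ θ) (outerSet S.r) := fun _ hp =>
  (h.jointHol_L hθ hp).analyticAt.differentiableAt.differentiableWithinAt

theorem HasForm.holAtInfty_L_sub : HolAtInfty S.r (fun p => S.L₀ θ p - p) (S.u₀ θ) :=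
  HolAtInfty.of_hasSum h.r_nonneg ((h.differentiableOn_L hθ).sub differentiableOn_id)
    fun p hp => h.L_series _ _ _ hθ p hp

theorem HasForm.holAtInfty_L_div : HolAtInfty S.r (fun p => S.L₀ θ p * p⁻¹) 1 := by
  have h1 := ((h.holAtInfty_L_sub hθ).mul (HolAtInfty.inv_id h.r_nonneg)).add
    (HolAtInfty.const S.r 1)
  simp only [mul_zero, zero_add] at h1
  refine h1.congr fun p hp => ?_
  have := ne_zero_of_mem_outerSet h.r_nonneg hp
  field_simp
  ring

theorem HasForm.holAtInfty_div_L : HolAtInfty S.r (fun p => p * (S.L₀ θ p)⁻¹) 1 := by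
  have h1 := (h.holAtInfty_L_div hθ).inv (fun p hp => mul_ne_zero (h.L₀_ne_zero hθ hp)
    (inv_ne_zero (ne_zero_of_mem_outerSet h.r_nonneg hp))) one_ne_zero
  rw [inv_one] at h1
  refine h1.congr fun p hp => ?_
  simp only [mul_inv, inv_inv]
  ring

theorem HasForm.holAtInfty_inv_L : HolAtInfty S.r (fun p => (S.L₀ θ p)⁻¹) 0 := by
  have h1 := (HolAtInfty.inv_id h.r_nonneg).mul (h.holAtInfty_div_L hθ)
  simp only [zero_mul] at h1
  refine h1.congr fun p hp => ?_
  have := ne_zero_of_mem_outerSet h.r_nonneg hp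
  field_simp

theorem HasForm.holAtInfty_deriv_L : HolAtInfty S.r (deriv (S.L₀ θ)) 1 := by
  have h1 := ((h.holAtInfty_L_sub hθ).deriv h.r_nonneg).add (HolAtInfty.const S.r 1)
  simp only [zero_add] at h1
  refine h1.congr fun p hp => ?_
  have h2 := ((h.jointHol_L hθ hp).hasDerivAt_snd.sub (hasDerivAt_id p)).deriv
  have h3 : deriv (fun p => S.L₀ θ p - p) p = deriv (S.L₀ θ) p - 1 := h2
  simp only [h3]
  ring

theorem HasForm.analyticAt_series (hp : p ∈ ringSet S.r S.R) :
    AnalyticAt ℂ (fun l => ∑' n : ℕ+, (n : ℂ) * θ.1 n * l ^ (n : ℕ)) (S.L₀ θ p) :=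
  analyticAt_tsum_of_summable h.r_nonneg (h.holAtInfty_L_sub hθ)
    (fun q hq => h.t_summable _ _ _ hθ q hq.1 hq.2) hp

theorem HasForm.outerExtends_tail : OuterExtends S.r S.R (S.tail θ) 0 := by
  refine ((holAtInfty_tsum_inv h.r_nonneg (L := S.L₀ θ) (a := fun n => S.u n θ.1 0 θ.2)
    (v := fun n => S.v n θ.1 0 θ.2) (fun p hp => h.L₀_ne_zero hθ hp)
    (fun p hp => h.L_series _ _ _ hθ p hp)
    (fun p hp => h.v_summable _ _ _ hθ p hp)).outerExtends S.R).congr fun p hp => ?_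
  have := h.M_series _ _ _ hθ p hp.1 hp.2
  simp only [tail, M₀, L₀, this]
  ring

theorem HasForm.eventually_ring (hp : p ∈ ringSet S.r S.R) (d : Option ℕ+) :
    ∀ᶠ x : ℂ × ℂ in 𝓝 (coord d θ, p), move d θ x.1 ∈ S.slice ∧ x.2 ∈ ringSet S.r S.R := by
  rw [nhds_prod_eq]
  exact (h.dirOpen θ hθ d).prod_mk ((isOpen_ringSet _ _).mem_nhds hp)

/-- Near a given point `M` is the series `∑ n tₙ λⁿ` with fixed coefficients at `λ = L`, plus terms
in which the moving parameter occurs explicitly, plus the tail. Only the analyticity of one power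
series in `λ` is thus needed. -/
theorem HasForm.eventually_M_eq (hp : p ∈ ringSet S.r S.R) (d : Option ℕ+) :
    ∀ᶠ x : ℂ × ℂ in 𝓝 (coord d θ, p), S.M₀ (move d θ x.1) x.2
      = (∑' n : ℕ+, (n : ℂ) * θ.1 n * S.L₀ (move d θ x.1) x.2 ^ (n : ℕ))
        + (x.1 - coord d θ) * explicitDeriv d (S.L₀ (move d θ x.1) x.2) + θ.2
        + S.tail (move d θ x.1) x.2 := by
  filter_upwards [h.eventually_ring hθ hp d] with x hx
  cases d with
  | none => simp only [tail, move, coord, explicitDeriv]; ring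
  | some n =>
    have := tsum_update_time (h.t_summable _ _ _ hx.1 x.2 hx.2.1 hx.2.2)
    simp only [tail, move, coord, explicitDeriv, L₀] at this ⊢
    rw [this]
    ring

theorem HasForm.analyticAt_explicitDeriv (hp : p ∈ outerSet S.r) (d : Option ℕ+) :
    AnalyticAt ℂ (fun x : ℂ × ℂ => explicitDeriv d (S.L₀ (move d θ x.1) x.2)) (coord d θ, p) := by
  cases d with
  | none => exact analyticAt_const
  | some n => exact analyticAt_const.mul ((h.jointHol_L hθ hp (some n)).pow n)

theorem HasForm.jointHol_tail (hp : p ∈ ringSet S.r S.R) : JointHol S.tail θ p := by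
  intro d
  have h1 : AnalyticAt ℂ (fun x : ℂ × ℂ =>
      ∑' n : ℕ+, (n : ℂ) * θ.1 n * S.L₀ (move d θ x.1) x.2 ^ (n : ℕ)) (coord d θ, p) := by
    refine AnalyticAt.fun_comp (g := fun l => ∑' n : ℕ+, (n : ℂ) * θ.1 n * l ^ (n : ℕ))
      (f := fun x : ℂ × ℂ => S.L₀ (move d θ x.1) x.2) ?_ (h.jointHol_L hθ hp.1 d)
    simpa using h.analyticAt_series hθ hp
  have h2 := ((((h.jointHol_M hθ hp) d).sub h1).sub
    ((analyticAt_fst.sub (analyticAt_const (v := coord d θ))).mul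
      (h.analyticAt_explicitDeriv hθ hp.1 d))).sub (analyticAt_const (v := θ.2))
  refine h2.congr ?_
  filter_upwards [h.eventually_M_eq hθ hp d] with x hx
  simp only [Pi.sub_apply, Pi.mul_apply]
  rw [hx]
  ring

/-- The derivatives of `M` differ from those of the tail, apart from the explicit terms, by a common
multiple of the derivatives of `L`. -/
theorem HasForm.exists_deriv_M (hp : p ∈ ringSet S.r S.R) :
    ∃ a : ℂ, deriv (S.M₀ θ) p = a * deriv (S.L₀ θ) p + deriv (S.tail θ) p ∧
      ∀ d, pderiv d (fun θ => S.M₀ θ p) θ = a * pderiv d (fun θ => S.L₀ θ p) θ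
        + (explicitDeriv d (S.L₀ θ p) + pderiv d (fun θ => S.tail θ p) θ) := by
  set ψ : ℂ → ℂ := fun l => ∑' n : ℕ+, (n : ℂ) * θ.1 n * l ^ (n : ℕ) with hψ
  have hψd : HasDerivAt ψ (deriv ψ (S.L₀ θ p)) (S.L₀ θ p) :=
    (h.analyticAt_series hθ hp).differentiableAt.hasDerivAt
  have hL := h.jointHol_L hθ hp.1
  have hT := h.jointHol_tail hθ hp
  refine ⟨deriv ψ (S.L₀ θ p), ?_, fun d => ?_⟩
  · have h1 := ((hψd.comp p hL.hasDerivAt_snd).add_const θ.2).add hT.hasDerivAt_snd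
    refine (h1.congr_of_eventuallyEq ?_).deriv
    refine Eventually.of_forall fun q => ?_
    simp only [Pi.add_apply, Function.comp, hψ, tail]
    ring
  · have h0 : S.L₀ (move d θ (coord d θ)) p = S.L₀ θ p := by simp
    have h1 := (HasDerivAt.comp (h₂ := ψ) (h := fun z => S.L₀ (move d θ z) p) (coord d θ)
      (by rw [h0]; exact hψd) (hL.hasDerivAt d))
    have h2 := ((hasDerivAt_id (coord d θ)).sub_const (coord d θ)).mul
      (AnalyticAt.curry_fst' (F := fun z q => explicitDeriv d (S.L₀ (move d θ z) q))
        (h.analyticAt_explicitDeriv hθ hp.1 d)).differentiableAt.hasDerivAt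
    have h3 := ((h1.add h2).add_const θ.2).add (hT.hasDerivAt d)
    have hev : ∀ᶠ z in 𝓝 (coord d θ), S.M₀ (move d θ z) p = _ :=
      (Continuous.tendsto (f := fun z : ℂ => (z, p)) (by fun_prop) (coord d θ)).eventually
        (h.eventually_M_eq hθ hp d)
    refine (h3.congr_of_eventuallyEq ?_).deriv.trans ?_
    · filter_upwards [hev] with z hz
      rw [hz]
      simp [hψ]
    · simp
      ring

/-- `L̄` has a simple zero at the origin, and `(M̄ - s) / L̄` is holomorphic there. -/
theorem HasForm.exists_factor :
    ∃ A Φ : ℂ → ℂ, DifferentiableOn ℂ A (Metric.ball 0 S.R) ∧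
      DifferentiableOn ℂ Φ (Metric.ball 0 S.R) ∧ (∀ q ∈ Metric.ball (0 : ℂ) S.R, A q ≠ 0) ∧
      (∀ q ∈ ringSet S.r S.R, S.Lb₀ θ q = q / A q) ∧
      ∀ q ∈ ringSet S.r S.R, S.Mb₀ θ q - θ.2 = S.Lb₀ θ q * Φ q := by
  have hR : 0 < S.R := h.r_nonneg.trans_lt h.r_lt_R
  obtain ⟨A, hA, hA0, hLA⟩ := exists_eq_div_of_hasSum (h.ub_zero_ne _ _ _ hθ)
    (fun q h0 h1 => h.Lb_ne _ _ _ hθ q h0 h1) (fun q h0 h1 => h.Lb_series _ _ _ hθ q h0 h1)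
  obtain ⟨Φ, hΦ, hΦe⟩ := exists_tsum_eq_mul_of_summable hR hA hA0 hLA
    (fun q h0 h1 => h.vb_summable _ _ _ hθ q h0 h1)
  refine ⟨A, Φ, hA, hΦ, hA0, fun q hq => hLA q (h.r_nonneg.trans_lt hq.1) hq.2, fun q hq => ?_⟩
  have h1 := h.Mb_series _ _ _ hθ q hq.1 hq.2
  have h2 := hΦe q (h.r_nonneg.trans_lt hq.1) hq.2
  simp only [Pi.zero_apply, mul_zero, zero_mul, tsum_zero, neg_zero, zero_add] at h1
  simp only [Mb₀, Lb₀, h1, h2]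
  ring

theorem HasForm.neg_Lb_div : NegPartVanishes 0 S.r S.R (fun p => S.Lb₀ θ p * p⁻¹) := by
  obtain ⟨A, Φ, hA, hΦ, hA0, hLA, hΦe⟩ := h.exists_factor hθ
  refine ⟨_, hA.inv hA0, fun k h1 h2 => ?_⟩
  have hk := mem_ringSet_of_norm_sub_zero h1 h2
  have := ne_zero_of_mem_outerSet h.r_nonneg hk.1
  simp only [hLA k hk, Pi.inv_apply]
  field_simp

theorem HasForm.neg_div_Lb : NegPartVanishes 0 S.r S.R (fun p => p * (S.Lb₀ θ p)⁻¹) := by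
  obtain ⟨A, Φ, hA, hΦ, hA0, hLA, hΦe⟩ := h.exists_factor hθ
  refine ⟨_, hA, fun k h1 h2 => ?_⟩
  have hk := mem_ringSet_of_norm_sub_zero h1 h2
  have := ne_zero_of_mem_outerSet h.r_nonneg hk.1
  simp only [hLA k hk, inv_div]
  field_simp

theorem HasForm.neg_Mb_div : NegPartVanishes 0 S.r S.R
    (fun p => (S.Mb₀ θ p - θ.2) * (S.Lb₀ θ p)⁻¹) := by
  obtain ⟨A, Φ, hA, hΦ, hA0, hLA, hΦe⟩ := h.exists_factor hθ
  refine ⟨_, hΦ, fun k h1 h2 => ?_⟩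
  have hk := mem_ringSet_of_norm_sub_zero h1 h2
  have := h.Lb₀_ne_zero hθ hk
  simp only [hΦe k hk]
  field_simp

theorem HasForm.neg_Lb : NegPartVanishes 0 S.r S.R (S.Lb₀ θ) := by
  refine ((h.neg_Lb_div hθ).mul (.of_differentiableOn differentiableOn_id)).congr
    fun k h1 h2 => ?_
  have := ne_zero_of_mem_outerSet h.r_nonneg (mem_ringSet_of_norm_sub_zero h1 h2).1
  simp only [id]
  field_simp

theorem HasForm.neg_Mb : NegPartVanishes 0 S.r S.R (S.Mb₀ θ) := by
  refine (((h.neg_Mb_div hθ).mul (h.neg_Lb hθ)).add (.const 0 S.r S.R θ.2)).congr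
    fun k h1 h2 => ?_
  have := h.Lb₀_ne_zero hθ (mem_ringSet_of_norm_sub_zero h1 h2)
  field_simp
  ring

end Form

end DTodaQuadruple

namespace DTodaQuadruple

/-! ### The Laurent polynomials `Bₙ` -/

/-- The `j`-th remainder in the expansion `(L / p)ⁿ = ∑ cⱼ p⁻ʲ`, multiplied by `pʲ`, so that the
coefficient `cⱼ` is its limit at infinity. -/
def remainder (S : DTodaQuadruple) (n : ℕ) : ℕ → TodaPoint → ℂ → ℂ
  | 0 => fun θ p => (S.L₀ θ p * p⁻¹) ^ n
  | j + 1 => fun θ p => p * (remainder S n j θ p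
      - limUnder (Bornology.cobounded ℂ) (remainder S n j θ))

/-- The coefficient of `pⁿ⁻ʲ` in `Lⁿ`. -/
def coeff (S : DTodaQuadruple) (n j : ℕ) (θ : TodaPoint) : ℂ :=
  limUnder (Bornology.cobounded ℂ) (S.remainder n j θ)

/-- The polynomial part of `Lⁿ` in `p`. -/
def powPoly (S : DTodaQuadruple) (n : ℕ) (θ : TodaPoint) : Polynomial ℂ :=
  ∑ i ∈ Finset.range (n + 1), Polynomial.C (S.coeff n i θ) * Polynomial.X ^ (n - i)

/-- The polynomial part of `Lⁿ` in `p`, its coefficients being differentiated in a direction. -/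
def powPolyDeriv (S : DTodaQuadruple) (d : Option ℕ+) (n : ℕ) (θ : TodaPoint) : Polynomial ℂ :=
  ∑ i ∈ Finset.range (n + 1), Polynomial.C (pderiv d (S.coeff n i) θ) * Polynomial.X ^ (n - i)

/-- The part of `Lⁿ` in negative powers of `p`. -/
def powNeg (S : DTodaQuadruple) (n : ℕ) (θ : TodaPoint) (p : ℂ) : ℂ :=
  p⁻¹ * S.remainder n (n + 1) θ p

variable {S : DTodaQuadruple}

theorem div_pow_eq_sum (n j : ℕ) (θ : TodaPoint) {p : ℂ} (hp : p ≠ 0) :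
    (S.L₀ θ p * p⁻¹) ^ n
      = ∑ i ∈ Finset.range j, S.coeff n i θ * p⁻¹ ^ i + p⁻¹ ^ j * S.remainder n j θ p := by
  induction j with
  | zero => simp [remainder]
  | succ j ih =>
    have h1 : S.remainder n (j + 1) θ p = p * (S.remainder n j θ p - S.coeff n j θ) := rfl
    rw [ih, Finset.sum_range_succ, h1, pow_succ]
    field_simp
    ring

theorem pow_eq_eval_add (n : ℕ) (θ : TodaPoint) {p : ℂ} (hp : p ≠ 0) :
    S.L₀ θ p ^ n = (S.powPoly n θ).eval p + S.powNeg n θ p := by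
  have h1 : S.L₀ θ p ^ n = p ^ n * (S.L₀ θ p * p⁻¹) ^ n := by
    rw [← mul_pow]; congr 1; field_simp
  rw [h1, div_pow_eq_sum n (n + 1) θ hp, mul_add, Finset.mul_sum, powPoly,
    Polynomial.eval_finsetSum, powNeg]
  congr 1
  · refine Finset.sum_congr rfl fun i hi => ?_
    have hi' : i ≤ n := Nat.lt_succ_iff.mp (Finset.mem_range.mp hi)
    simp only [Polynomial.eval_mul, Polynomial.eval_C, Polynomial.eval_pow, Polynomial.eval_X]
    rw [pow_sub₀ _ hp hi', inv_pow]
    ring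
  · rw [pow_succ, inv_pow]
    field_simp

section Form

variable (h : S.HasForm)
include h

theorem HasForm.holAtInfty_remainder (n j : ℕ) {θ : TodaPoint} (hθ : θ ∈ S.slice) :
    HolAtInfty S.r (S.remainder n j θ) (S.coeff n j θ) := by
  have hlim : ∀ j, (∃ e, HolAtInfty S.r (S.remainder n j θ) e) →
      HolAtInfty S.r (S.remainder n j θ) (S.coeff n j θ) := by
    rintro j ⟨e, he⟩
    have : S.coeff n j θ = e := he.lim.limUnder_eq
    rwa [this]
  induction j with
  | zero => exact hlim 0 ⟨_, (h.holAtInfty_L_div hθ).pow n⟩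
  | succ j ih => exact hlim (j + 1) (ih.exists_peel h.r_nonneg)

theorem HasForm.jointHol_remainder_and_paramHol (n j : ℕ) :
    (∀ θ ∈ S.slice, ∀ p ∈ ringSet S.r S.R, JointHol (S.remainder n j) θ p) ∧
      ∀ θ ∈ S.slice, ParamHol (S.coeff n j) θ := by
  have hpar : ∀ j, (∀ θ ∈ S.slice, ∀ p ∈ ringSet S.r S.R, JointHol (S.remainder n j) θ p) →
      ∀ θ ∈ S.slice, ParamHol (S.coeff n j) θ := fun j hj θ hθ =>
    OuterExtends.paramHol h.r_nonneg h.r_lt_R h.dirOpen hj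
      (fun θ hθ => (h.holAtInfty_remainder n j hθ).outerExtends S.R) hθ
  induction j with
  | zero =>
    have h0 : ∀ θ ∈ S.slice, ∀ p ∈ ringSet S.r S.R, JointHol (S.remainder n 0) θ p :=
      fun θ hθ p hp => ((h.jointHol_L hθ hp.1).mul ((JointHol.id θ p).inv
        (ne_zero_of_mem_outerSet h.r_nonneg hp.1))).pow n
    exact ⟨h0, hpar 0 h0⟩
  | succ j ih =>
    have h1 : ∀ θ ∈ S.slice, ∀ p ∈ ringSet S.r S.R, JointHol (S.remainder n (j + 1)) θ p :=
      fun θ hθ p hp => (JointHol.id θ p).mul ((ih.1 θ hθ p hp).sub ((ih.2 θ hθ).jointHol p))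
    exact ⟨h1, hpar (j + 1) h1⟩

variable {θ : TodaPoint} (hθ : θ ∈ S.slice)
include hθ

theorem HasForm.paramHol_coeff (n j : ℕ) : ParamHol (S.coeff n j) θ :=
  (h.jointHol_remainder_and_paramHol n j).2 θ hθ

theorem HasForm.holAtInfty_powNeg (n : ℕ) : HolAtInfty S.r (S.powNeg n θ) 0 := by
  simpa using! (HolAtInfty.inv_id h.r_nonneg).mul (h.holAtInfty_remainder n (n + 1) hθ)

theorem HasForm.jointHol_powNeg (n : ℕ) {p : ℂ} (hp : p ∈ ringSet S.r S.R) :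
    JointHol (S.powNeg n) θ p :=
  ((JointHol.id θ p).inv (ne_zero_of_mem_outerSet h.r_nonneg hp.1)).mul
    ((h.jointHol_remainder_and_paramHol n (n + 1)).1 θ hθ p hp)

theorem HasForm.jointHol_powPoly (n : ℕ) (p : ℂ) :
    JointHol (fun θ p => (S.powPoly n θ).eval p) θ p := by
  simp only [powPoly, Polynomial.eval_finsetSum, Polynomial.eval_mul, Polynomial.eval_C,
    Polynomial.eval_pow, Polynomial.eval_X]
  exact JointHol.sum _ fun i _ => ((h.paramHol_coeff hθ n i).jointHol p).mul
    ((JointHol.id θ p).pow _)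

theorem HasForm.pderiv_powPoly (d : Option ℕ+) (n : ℕ) (p : ℂ) :
    pderiv d (fun θ => (S.powPoly n θ).eval p) θ = (S.powPolyDeriv d n θ).eval p := by
  simp only [powPoly, powPolyDeriv, Polynomial.eval_finsetSum, Polynomial.eval_mul,
    Polynomial.eval_C, Polynomial.eval_pow, Polynomial.eval_X]
  exact (HasDerivAt.fun_sum fun i _ =>
    ((h.paramHol_coeff hθ n i).hasDerivAt d).mul_const _).deriv

theorem HasForm.polyPart_pow (n : ℕ) : polyPart (fun p => S.L₀ θ p ^ n) = S.powPoly n θ := by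
  refine polyPart_eq _ _ ((h.holAtInfty_powNeg hθ n).lim.congr' ?_)
  filter_upwards [eventually_cobounded_mem_outerSet S.r] with p hp
  rw [pow_eq_eval_add n θ (ne_zero_of_mem_outerSet h.r_nonneg hp)]
  ring

theorem HasForm.powPoly_one : S.powPoly 1 θ = Polynomial.X + Polynomial.C (S.u₀ θ) := by
  rw [← h.polyPart_pow hθ 1]
  refine polyPart_eq _ _ ?_
  have h1 := (h.holAtInfty_L_sub hθ).lim.sub_const (S.u₀ θ)
  rw [sub_self] at h1
  refine h1.congr fun p => ?_
  simp
  ring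

theorem HasForm.paramHol_u : ParamHol S.u₀ θ :=
  OuterExtends.paramHol h.r_nonneg h.r_lt_R h.dirOpen
    (F := fun θ p => S.L₀ θ p - p)
    (fun _ hθ p hp => (h.jointHol_L hθ hp.1).sub (JointHol.id _ p))
    (fun _ hθ => (h.holAtInfty_L_sub hθ).outerExtends S.R) hθ

theorem HasForm.powPolyDeriv_one (d : Option ℕ+) (p : ℂ) :
    (S.powPolyDeriv d 1 θ).eval p = pderiv d S.u₀ θ := by
  rw [← h.pderiv_powPoly hθ]
  have h1 := ((h.paramHol_u hθ).hasDerivAt d).const_add p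
  refine (h1.congr_of_eventuallyEq ?_).deriv
  filter_upwards [h.dirOpen θ hθ d] with z hz
  simp [h.powPoly_one hz]

theorem HasForm.outerExtends_pderiv_L (d : Option ℕ+) :
    OuterExtends S.r S.R (fun p => pderiv d (fun θ => S.L₀ θ p) θ) (pderiv d S.u₀ θ) := by
  refine (OuterExtends.pderiv h.r_nonneg h.r_lt_R h.dirOpen (F := fun θ p => S.L₀ θ p - p)
    (fun _ hθ p hp => (h.jointHol_L hθ hp.1).sub (JointHol.id _ p))
    (fun _ hθ => (h.holAtInfty_L_sub hθ).outerExtends S.R) hθ d).congr fun p hp => ?_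
  exact (((h.jointHol_L hθ hp.1).hasDerivAt d).sub_const p).deriv.symm

theorem HasForm.outerExtends_pderiv_tail (d : Option ℕ+) :
    OuterExtends S.r S.R (fun p => pderiv d (fun θ => S.tail θ p) θ) 0 := by
  have h1 := OuterExtends.pderiv h.r_nonneg h.r_lt_R h.dirOpen (F := S.tail) (e := fun _ => 0)
    (fun _ hθ p hp => h.jointHol_tail hθ hp) (fun _ hθ => h.outerExtends_tail hθ) hθ d
  simpa [pderiv] using h1

theorem HasForm.outerExtends_pderiv_powNeg (d : Option ℕ+) (n : ℕ) :
    OuterExtends S.r S.R (fun p => pderiv d (fun θ => S.powNeg n θ p) θ) 0 := by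
  have h1 := OuterExtends.pderiv h.r_nonneg h.r_lt_R h.dirOpen (F := S.powNeg n) (e := fun _ => 0)
    (fun _ hθ p hp => h.jointHol_powNeg hθ n hp)
    (fun _ hθ => (h.holAtInfty_powNeg hθ n).outerExtends S.R) hθ d
  simpa [pderiv] using h1

theorem HasForm.outerExtends_mul_pderiv_powNeg (d : Option ℕ+) (n : ℕ) :
    OuterExtends S.r S.R (fun p => p * pderiv d (fun θ => S.powNeg n θ p) θ)
      (pderiv d (S.coeff n (n + 1)) θ) := by
  refine (OuterExtends.pderiv h.r_nonneg h.r_lt_R h.dirOpen (F := S.remainder n (n + 1))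
    (h.jointHol_remainder_and_paramHol n (n + 1)).1
    (fun _ hθ => (h.holAtInfty_remainder n (n + 1) hθ).outerExtends S.R) hθ d).congr
    fun p hp => ?_
  have hp0 := ne_zero_of_mem_outerSet h.r_nonneg hp.1
  have h1 := (((h.jointHol_remainder_and_paramHol n (n + 1)).1 θ hθ p hp).hasDerivAt d).const_mul
    p⁻¹
  have h2 : pderiv d (fun θ => S.powNeg n θ p) θ
    = p⁻¹ * pderiv d (fun θ => S.remainder n (n + 1) θ p) θ := h1.deriv
  simp only [h2]
  field_simp

theorem HasForm.deriv_pow (n : ℕ) {p : ℂ} (hp : p ∈ ringSet S.r S.R) :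
    n * S.L₀ θ p ^ (n - 1) * deriv (S.L₀ θ) p
      = (S.powPoly n θ).derivative.eval p + deriv (S.powNeg n θ) p := by
  have h1 := ((h.jointHol_L hθ hp.1).hasDerivAt_snd.pow n).deriv
  have h2 := ((S.powPoly n θ).hasDerivAt p).add (h.jointHol_powNeg hθ n hp).hasDerivAt_snd
  rw [← h2.deriv]
  refine h1.symm.trans (Filter.EventuallyEq.deriv_eq ?_)
  filter_upwards [isOpen_ne.mem_nhds (ne_zero_of_mem_outerSet h.r_nonneg hp.1)] with q hq
  exact pow_eq_eval_add n θ hq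

theorem HasForm.pderiv_pow (d : Option ℕ+) (n : ℕ) {p : ℂ} (hp : p ∈ ringSet S.r S.R) :
    n * S.L₀ θ p ^ (n - 1) * pderiv d (fun θ => S.L₀ θ p) θ
      = (S.powPolyDeriv d n θ).eval p + pderiv d (fun θ => S.powNeg n θ p) θ := by
  have h1 := (((h.jointHol_L hθ hp.1).hasDerivAt d).pow n).deriv
  have h2 := ((h.jointHol_powPoly hθ n p).hasDerivAt d).add
    ((h.jointHol_powNeg hθ n hp).hasDerivAt d)
  rw [← h.pderiv_powPoly hθ, ← h2.deriv]
  simp only [move_coord] at h1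
  refine h1.symm.trans (Filter.EventuallyEq.deriv_eq (Eventually.of_forall fun z => ?_))
  exact pow_eq_eval_add n _ (ne_zero_of_mem_outerSet h.r_nonneg hp.1)

end Form

/-! ### Jacobian determinants -/

/-- The derivative of `M` in a direction, up to a multiple of the derivative of `L`. -/
def reducedDeriv (S : DTodaQuadruple) (d : Option ℕ+) (θ : TodaPoint) (p : ℂ) : ℂ :=
  explicitDeriv d (S.L₀ θ p) + pderiv d (fun θ => S.tail θ p) θ

/-- The Jacobian determinant of `(L, M)` in `p` and a parameter. -/
def jacobianP (S : DTodaQuadruple) (d : Option ℕ+) (θ : TodaPoint) (p : ℂ) : ℂ :=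
  deriv (S.L₀ θ) p * S.reducedDeriv d θ p
    - pderiv d (fun θ => S.L₀ θ p) θ * deriv (S.tail θ) p

/-- The Jacobian determinant of `(L, M)` in `s` and another parameter. -/
def jacobianS (S : DTodaQuadruple) (d : Option ℕ+) (θ : TodaPoint) (p : ℂ) : ℂ :=
  pderiv none (fun θ => S.L₀ θ p) θ * S.reducedDeriv d θ p
    - pderiv d (fun θ => S.L₀ θ p) θ * S.reducedDeriv none θ p

section Twistor

variable {D : Set (ℂ × ℂ)} {f g : ℂ → ℂ → ℂ} (hfg : IsDTodaTwistorData D f g)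
  (h : S.IsTwistorSolution D f g)
include hfg h

variable {θ : TodaPoint} (hθ : θ ∈ S.slice)
include hθ

theorem IsTwistorSolution.exists_jacobian {p : ℂ} (hp : p ∈ ringSet S.r S.R) :
    ∃ f₁ f₂ g₁ g₂ : ℂ, S.L₀ θ p * (f₁ * g₂ - f₂ * g₁) = S.Lb₀ θ p ∧
      (deriv (S.Lb₀ θ) p = f₁ * deriv (S.L₀ θ) p + f₂ * deriv (S.M₀ θ) p ∧
        deriv (S.Mb₀ θ) p = g₁ * deriv (S.L₀ θ) p + g₂ * deriv (S.M₀ θ) p) ∧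
      ∀ d, pderiv d (fun θ => S.Lb₀ θ p) θ
          = f₁ * pderiv d (fun θ => S.L₀ θ p) θ + f₂ * pderiv d (fun θ => S.M₀ θ p) θ ∧
        pderiv d (fun θ => S.Mb₀ θ p) θ
          = g₁ * pderiv d (fun θ => S.L₀ θ p) θ + g₂ * pderiv d (fun θ => S.M₀ θ p) θ := by
  have hmem : (S.L₀ θ p, S.M₀ θ p) ∈ D := h.mem _ _ _ hθ p hp.1 hp.2
  have hf := hfg.hol_f.differentiableAt (hfg.isOpen.mem_nhds hmem)
  have hg := hfg.hol_g.differentiableAt (hfg.isOpen.mem_nhds hmem)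
  have hL := h.form.jointHol_L hθ hp.1
  have hM := h.form.jointHol_M hθ hp
  refine ⟨deriv (fun a => f a (S.M₀ θ p)) (S.L₀ θ p), deriv (fun b => f (S.L₀ θ p) b) (S.M₀ θ p),
    deriv (fun a => g a (S.M₀ θ p)) (S.L₀ θ p), deriv (fun b => g (S.L₀ θ p) b) (S.M₀ θ p),
    ?_, ⟨?_, ?_⟩, fun d => ⟨?_, ?_⟩⟩
  rotate_left
  · refine ((hasDerivAt_comp₂ hf hL.hasDerivAt_snd hM.hasDerivAt_snd).congr_of_eventuallyEq
      ?_).deriv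
    filter_upwards [(isOpen_ringSet _ _).mem_nhds hp] with q hq
    exact (h.f_eq _ _ _ hθ q hq.1 hq.2).symm
  · refine ((hasDerivAt_comp₂ hg hL.hasDerivAt_snd hM.hasDerivAt_snd).congr_of_eventuallyEq
      ?_).deriv
    filter_upwards [(isOpen_ringSet _ _).mem_nhds hp] with q hq
    exact (h.g_eq _ _ _ hθ q hq.1 hq.2).symm
  · have h1 := hasDerivAt_comp₂ (f := f) (by simpa only [move_coord] using hf) (hL.hasDerivAt d)
      (hM.hasDerivAt d)
    simp only [move_coord] at h1
    refine (h1.congr_of_eventuallyEq ?_).deriv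
    filter_upwards [h.form.dirOpen θ hθ d] with z hz
    exact (h.f_eq _ _ _ hz p hp.1 hp.2).symm
  · have h1 := hasDerivAt_comp₂ (f := g) (by simpa only [move_coord] using hg) (hL.hasDerivAt d)
      (hM.hasDerivAt d)
    simp only [move_coord] at h1
    refine (h1.congr_of_eventuallyEq ?_).deriv
    filter_upwards [h.form.dirOpen θ hθ d] with z hz
    exact (h.g_eq _ _ _ hz p hp.1 hp.2).symm
  · have h1 := hfg.bracket _ _ hmem
    have h2 : f (S.L₀ θ p) (S.M₀ θ p) = S.Lb₀ θ p := h.f_eq _ _ _ hθ p hp.1 hp.2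
    rw [← h2, ← h1]
    ring

/-- The relation `{f, g} = f` says that the twistor map takes `dL ∧ dM / L` to `dL̄ ∧ dM̄ / L̄`, so
that Jacobian determinants of `(L, M)` divided by `L` are those of `(L̄, M̄)` divided by `L̄`. -/
theorem IsTwistorSolution.neg_jacobianP (d : Option ℕ+) :
    NegPartVanishes 0 S.r S.R (fun p => p * (S.L₀ θ p)⁻¹ * S.jacobianP d θ p) := by
  have hr := h.form.r_nonneg
  have hrR := h.form.r_lt_R
  have hLd := NegPartVanishes.pderiv hr hrR h.form.dirOpen (fun _ hθ p hp => h.form.jointHol_Lb hθ hp)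
    (fun _ hθ => h.form.neg_Lb hθ) hθ d
  have hMd := NegPartVanishes.pderiv hr hrR h.form.dirOpen (fun _ hθ p hp => h.form.jointHol_Mb hθ hp)
    (fun _ hθ => h.form.neg_Mb hθ) hθ d
  refine ((h.form.neg_div_Lb hθ).mul (((h.form.neg_Lb hθ).deriv.mul hMd).sub
    (hLd.mul (h.form.neg_Mb hθ).deriv))).congr fun p hp hp' => ?_
  have hp := mem_ringSet_of_norm_sub_zero hp hp'
  obtain ⟨f₁, f₂, g₁, g₂, hJ, ⟨h1, h2⟩, h3⟩ := h.exists_jacobian hfg hθ hp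
  obtain ⟨a, ha, had⟩ := h.form.exists_deriv_M hθ hp
  have hL0 := h.form.L₀_ne_zero hθ hp.1
  have hLb0 := h.form.Lb₀_ne_zero hθ hp
  rw [h1, h2, (h3 d).1, (h3 d).2, ha, had d]
  simp only [jacobianP, reducedDeriv]
  field_simp
  rw [← hJ]
  ring

theorem IsTwistorSolution.neg_jacobianS (d : Option ℕ+) :
    NegPartVanishes 0 S.r S.R (fun p => (S.L₀ θ p)⁻¹ * S.jacobianS d θ p) := by
  have hr := h.form.r_nonneg
  have hrR := h.form.r_lt_R
  -- `L̄ / p` has no zero at the origin, so that logarithmic derivatives of `L̄` in the parameters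
  -- are holomorphic there
  have hLd := fun d => NegPartVanishes.pderiv (F := fun θ p => S.Lb₀ θ p * p⁻¹) hr hrR
    h.form.dirOpen (fun _ hθ p hp => (h.form.jointHol_Lb hθ hp).mul
      ((JointHol.id _ p).inv (ne_zero_of_mem_outerSet hr hp.1)))
    (fun _ hθ => h.form.neg_Lb_div hθ) hθ d
  have hMd := fun d => NegPartVanishes.pderiv hr hrR h.form.dirOpen
    (fun _ hθ p hp => h.form.jointHol_Mb hθ hp) (fun _ hθ => h.form.neg_Mb hθ) hθ d
  refine ((h.form.neg_div_Lb hθ).mul (((hLd none).mul (hMd d)).sub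
    ((hLd d).mul (hMd none)))).congr fun p hp hp' => ?_
  have hp := mem_ringSet_of_norm_sub_zero hp hp'
  have hp0 := ne_zero_of_mem_outerSet hr hp.1
  obtain ⟨f₁, f₂, g₁, g₂, hJ, -, h3⟩ := h.exists_jacobian hfg hθ hp
  obtain ⟨a, -, had⟩ := h.form.exists_deriv_M hθ hp
  have hL0 := h.form.L₀_ne_zero hθ hp.1
  have hLb0 := h.form.Lb₀_ne_zero hθ hp
  have h4 : ∀ d, pderiv d (fun θ => S.Lb₀ θ p * p⁻¹) θ
      = pderiv d (fun θ => S.Lb₀ θ p) θ * p⁻¹ := fun d =>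
    (((h.form.jointHol_Lb hθ hp).hasDerivAt d).mul_const p⁻¹).deriv
  rw [h4, h4, (h3 d).1, (h3 d).2, (h3 none).1, (h3 none).2, had d, had none]
  simp only [jacobianS, reducedDeriv]
  field_simp
  rw [← hJ]
  ring

theorem IsTwistorSolution.jacobianP_none {p : ℂ} (hp : p ∈ ringSet S.r S.R) :
    p * S.jacobianP none θ p = S.L₀ θ p := by
  have hF := h.form
  have h1 := ((hF.holAtInfty_div_L hθ).outerExtends S.R).mul
    ((((hF.holAtInfty_deriv_L hθ).outerExtends S.R).mul
      (((HolAtInfty.const S.r 1).outerExtends S.R).add (hF.outerExtends_pderiv_tail hθ none))).sub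
      ((hF.outerExtends_pderiv_L hθ none).mul ((hF.outerExtends_tail hθ).deriv hF.r_nonneg)))
  have h2 := h1.eq_of_negPartVanishes hF.r_lt_R (h.neg_jacobianP hfg hθ none) p hp
  have hL0 := hF.L₀_ne_zero hθ hp.1
  simp only [add_zero, mul_zero, sub_zero, mul_one] at h2
  have h3 : p * (S.L₀ θ p)⁻¹ * S.jacobianP none θ p = 1 := h2
  field_simp at h3
  exact h3

theorem IsTwistorSolution.jacobianP_some (n : ℕ+) {p : ℂ} (hp : p ∈ ringSet S.r S.R) :
    S.jacobianP (some n) θ p = S.L₀ θ p * (S.powPoly n θ).derivative.eval p := by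
  have hF := h.form
  have h1 := ((((hF.holAtInfty_powNeg hθ n).outerExtends S.R).mul_deriv hF.r_nonneg)).add
    (((hF.holAtInfty_div_L hθ).outerExtends S.R).mul
    ((((hF.holAtInfty_deriv_L hθ).outerExtends S.R).mul
      (hF.outerExtends_pderiv_tail hθ (some n))).sub
      ((hF.outerExtends_pderiv_L hθ (some n)).mul ((hF.outerExtends_tail hθ).deriv hF.r_nonneg))))
  simp only [mul_zero, sub_zero, add_zero] at h1
  have h2 := (h.neg_jacobianP hfg hθ (some n)).sub (.of_differentiableOn (F := fun p =>
    p * (S.powPoly n θ).derivative.eval p) (by fun_prop))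
  have h3 := (h1.congr fun q hq => ?_).eq_of_negPartVanishes hF.r_lt_R h2 p hp
  · have hL0 := hF.L₀_ne_zero hθ hp.1
    have hp0 := ne_zero_of_mem_outerSet hF.r_nonneg hp.1
    field_simp at h3
    refine mul_left_cancel₀ hp0 ?_
    linear_combination h3
  · have hL0 := hF.L₀_ne_zero hθ hq.1
    have h4 := hF.deriv_pow hθ n hq
    have h5 : S.L₀ θ q ^ (n : ℕ) = S.L₀ θ q * S.L₀ θ q ^ ((n : ℕ) - 1) := by
      rw [← pow_succ', Nat.sub_add_cancel n.pos]
    simp only [jacobianP, reducedDeriv, explicitDeriv, h5]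
    field_simp
    linear_combination q * S.L₀ θ q * h4

theorem IsTwistorSolution.jacobianS_some (n : ℕ+) {p : ℂ} (hp : p ∈ ringSet S.r S.R) :
    S.jacobianS (some n) θ p = S.L₀ θ p * (S.powPolyDeriv none n θ).eval p := by
  have hF := h.form
  have h1 := (hF.outerExtends_pderiv_powNeg hθ none n).add
    (((hF.holAtInfty_inv_L hθ).outerExtends S.R).mul
    (((hF.outerExtends_pderiv_L hθ none).mul
      (hF.outerExtends_pderiv_tail hθ (some n))).sub
      ((hF.outerExtends_pderiv_L hθ (some n)).mul
        (((HolAtInfty.const S.r 1).outerExtends S.R).add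
          (hF.outerExtends_pderiv_tail hθ none)))))
  simp only [zero_mul, add_zero] at h1
  have h2 := (h.neg_jacobianS hfg hθ (some n)).sub (.of_differentiableOn (F := fun p =>
    (S.powPolyDeriv none n θ).eval p) (by fun_prop))
  have h3 := (h1.congr fun q hq => ?_).eq_of_negPartVanishes hF.r_lt_R h2 p hp
  · have hL0 := hF.L₀_ne_zero hθ hp.1
    field_simp at h3
    linear_combination h3
  · have hL0 := hF.L₀_ne_zero hθ hq.1
    have h4 := hF.pderiv_pow hθ none n hq
    have h5 : S.L₀ θ q ^ (n : ℕ) = S.L₀ θ q * S.L₀ θ q ^ ((n : ℕ) - 1) := by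
      rw [← pow_succ', Nat.sub_add_cancel n.pos]
    simp only [jacobianS, reducedDeriv, explicitDeriv, h5]
    field_simp
    linear_combination S.L₀ θ q * h4

/-! ### Lax equations of the Toda hierarchy -/

theorem IsTwistorSolution.lax_L_ring (n : ℕ+) {p : ℂ} (hp : p ∈ ringSet S.r S.R) :
    pderiv (some n) (fun θ => S.L₀ θ p) θ
      = p * ((S.powPoly n θ).derivative.eval p * pderiv none (fun θ => S.L₀ θ p) θ
        - (S.powPolyDeriv none n θ).eval p * deriv (S.L₀ θ) p) := by
  have h1 := h.jacobianP_none hfg hθ hp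
  have h2 := h.jacobianP_some hfg hθ n hp
  have h3 := h.jacobianS_some hfg hθ n hp
  have hL0 := h.form.L₀_ne_zero hθ hp.1
  -- three vectors in the plane are related by their pairwise determinants
  have h4 : deriv (S.L₀ θ) p * S.jacobianS (some n) θ p
      - pderiv none (fun θ => S.L₀ θ p) θ * S.jacobianP (some n) θ p
      + pderiv (some n) (fun θ => S.L₀ θ p) θ * S.jacobianP none θ p = 0 := by
    simp only [jacobianS, jacobianP]; ring
  rw [h2, h3] at h4
  refine mul_left_cancel₀ hL0 ?_
  linear_combination p * h4 - pderiv (some n) (fun θ => S.L₀ θ p) θ * h1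

theorem IsTwistorSolution.lax_M_ring (n : ℕ+) {p : ℂ} (hp : p ∈ ringSet S.r S.R) :
    pderiv (some n) (fun θ => S.M₀ θ p) θ
      = p * ((S.powPoly n θ).derivative.eval p * pderiv none (fun θ => S.M₀ θ p) θ
        - (S.powPolyDeriv none n θ).eval p * deriv (S.M₀ θ) p) := by
  have h0 := h.lax_L_ring hfg hθ n hp
  have h1 := h.jacobianP_none hfg hθ hp
  have h2 := h.jacobianP_some hfg hθ n hp
  have h3 := h.jacobianS_some hfg hθ n hp
  have hL0 := h.form.L₀_ne_zero hθ hp.1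
  obtain ⟨a, ha, had⟩ := h.form.exists_deriv_M hθ hp
  have h4 : deriv (S.tail θ) p * S.jacobianS (some n) θ p
      - S.reducedDeriv none θ p * S.jacobianP (some n) θ p
      + S.reducedDeriv (some n) θ p * S.jacobianP none θ p = 0 := by
    simp only [jacobianS, jacobianP]; ring
  rw [h2, h3] at h4
  have h5 : S.reducedDeriv (some n) θ p
      = p * ((S.powPoly n θ).derivative.eval p * S.reducedDeriv none θ p
        - (S.powPolyDeriv none n θ).eval p * deriv (S.tail θ) p) := by
    refine mul_left_cancel₀ hL0 ?_
    linear_combination p * h4 - S.reducedDeriv (some n) θ p * h1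
  rw [had, had, ha]
  simp only [reducedDeriv] at h5
  linear_combination a * h0 + h5

theorem IsTwistorSolution.lax_L (n : ℕ+) {p : ℂ} (hp : p ∈ outerSet S.r) :
    pderiv (some n) (fun θ => S.L₀ θ p) θ
      = p * ((S.powPoly n θ).derivative.eval p * pderiv none (fun θ => S.L₀ θ p) θ
        - (S.powPolyDeriv none n θ).eval p * deriv (S.L₀ θ) p) := by
  have hd : ∀ d, DifferentiableOn ℂ (fun p => pderiv d (fun θ => S.L₀ θ p) θ) (outerSet S.r) :=
    fun d q hq => ((h.form.jointHol_L hθ hq).analyticAt_pderiv d).differentiableAt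
      |>.differentiableWithinAt
  refine eqOn_outerSet_of_eqOn_ringSet h.form.r_nonneg h.form.r_lt_R (hd (some n)) ?_
    (fun q hq => h.lax_L_ring hfg hθ n hq) hp
  have h1 : DifferentiableOn ℂ (fun p => (S.powPoly n θ).derivative.eval p) (outerSet S.r) := by
    fun_prop
  have h2 : DifferentiableOn ℂ (fun p => (S.powPolyDeriv none n θ).eval p) (outerSet S.r) := by
    fun_prop
  exact differentiableOn_id.mul ((h1.mul (hd none)).sub
    (h2.mul ((h.form.differentiableOn_L hθ).deriv (isOpen_outerSet _))))

/-- The zero-curvature equation for the flows `t₁` and `tₙ`. -/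
theorem IsTwistorSolution.zero_curvature (n : ℕ+) (p : ℂ) :
    (S.powPolyDeriv (some 1) n θ).eval p - pderiv (some n) S.u₀ θ
      = p * ((S.powPolyDeriv none n θ).eval p
        - pderiv none S.u₀ θ * (S.powPoly n θ).derivative.eval p) := by
  have hF := h.form
  have hN1 := hF.outerExtends_pderiv_powNeg hθ (some 1) n
  have hNs := hF.outerExtends_mul_pderiv_powNeg hθ none n
  have hNp := ((hF.holAtInfty_powNeg hθ n).outerExtends S.R).mul_deriv hF.r_nonneg
  have hu := fun a : ℂ => (HolAtInfty.const S.r a).outerExtends S.R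
  -- the residue of `Lⁿ`, differentiated in `s`, is the `tₙ`-derivative of `u₀`
  have hres : pderiv none (S.coeff n (n + 1)) θ = pderiv (some n) S.u₀ θ := by
    have h1 := (hNs.mul ((hF.holAtInfty_deriv_L hθ).outerExtends S.R)).sub
      (hNp.mul (hF.outerExtends_pderiv_L hθ none))
    simp only [mul_one, zero_mul, sub_zero] at h1
    refine h1.unique hF.r_nonneg hF.r_lt_R
      ((hF.outerExtends_pderiv_L hθ (some n)).congr fun q hq => ?_)
    have h2 := hF.deriv_pow hθ n hq
    have h3 := hF.pderiv_pow hθ none n hq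
    simp only
    rw [h.lax_L_ring hfg hθ n hq]
    linear_combination q * pderiv none (fun θ => S.L₀ θ q) θ * h2 - q * deriv (S.L₀ θ) q * h3
  set Q : Polynomial ℂ := S.powPolyDeriv (some 1) n θ - Polynomial.C (pderiv (some n) S.u₀ θ)
    - Polynomial.X * (S.powPolyDeriv none n θ
      - Polynomial.C (pderiv none S.u₀ θ) * (S.powPoly n θ).derivative) with hQ
  have hQ0 : ∀ q ∈ ringSet S.r S.R, Q.eval q = 0 := by
    have h1 := ((hNs.sub hN1).sub ((hu (pderiv none S.u₀ θ)).mul hNp)).sub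
      (hu (pderiv (some n) S.u₀ θ))
    rw [hres] at h1
    simp only [mul_zero, sub_zero, sub_self] at h1
    refine (h1.congr fun q hq => ?_).eq_of_negPartVanishes hF.r_lt_R
      (.of_differentiableOn (by fun_prop))
    have h2 := hF.deriv_pow hθ n hq
    have h3 := hF.pderiv_pow hθ none n hq
    have h4 := hF.pderiv_pow hθ (some 1) n hq
    have h5 := h.lax_L_ring hfg hθ 1 hq
    simp only [PNat.one_coe, hF.powPoly_one hθ, hF.powPolyDeriv_one hθ, Polynomial.derivative_add,
      Polynomial.derivative_X, Polynomial.derivative_C, add_zero, Polynomial.eval_one,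
      one_mul] at h5
    simp only [hQ, Polynomial.eval_sub, Polynomial.eval_mul, Polynomial.eval_C, Polynomial.eval_X]
    linear_combination (n * S.L₀ θ q ^ ((n : ℕ) - 1)) * h5 - h4 + q * h3
      - q * pderiv none S.u₀ θ * h2
  have hQz : Q = 0 := by
    obtain ⟨q, hq⟩ := ringSet_nonempty hF.r_nonneg hF.r_lt_R
    exact Polynomial.eq_zero_of_infinite_isRoot Q ((infinite_of_mem_nhds q
      ((isOpen_ringSet S.r S.R).mem_nhds hq)).mono fun x hx => hQ0 x hx)
  have := congrArg (Polynomial.eval p) hQz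
  simp only [hQ, Polynomial.eval_sub, Polynomial.eval_mul, Polynomial.eval_C, Polynomial.eval_X,
    Polynomial.eval_zero] at this
  linear_combination this

end Twistor

end DTodaQuadruple

/-! ### Change of variables from Toda to mKP -/

namespace DTodaQuadruple

theorem mk_shiftTime_eq_move (x z : ℂ) (t : Times) (s : ℂ) :
    ((shiftTime z t, s) : TodaPoint) = move (some 1) (shiftTime x t, s) (z + t 1) := by
  simp [move, shiftTime, add_comm]

theorem mk_shiftTime_update_eq_move (x : ℂ) (t : Times) (n : ℕ+) (z s : ℂ) :
    ((shiftTime x (Function.update t n z), s) : TodaPoint)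
      = move (some n) (shiftTime x t, s) (z + (shiftTime x t n - t n)) := by
  by_cases hn : n = 1
  · subst hn
    simp [move, shiftTime]
  · have h1 : Function.update t n z 1 = t 1 := Function.update_of_ne (Ne.symm hn) _ _
    simp only [move, shiftTime, h1, Function.update_of_ne hn, sub_self, add_zero]
    rw [Function.update_comm hn]

/-- `F(t, s; p)` as a function of the mKP variables: the first time is `t₁ + x`, and
`p = k - u₀`. -/
def shifted (S : DTodaQuadruple) (F : TodaPoint → ℂ → ℂ) : ℂ → Times → ℂ → ℂ → ℂ :=
  fun x t s k => F (shiftTime x t, s) (k - S.u₀ (shiftTime x t, s))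

variable {S : DTodaQuadruple} {F G : TodaPoint → ℂ → ℂ}

theorem analyticAt_shift {θ : TodaPoint} {k : ℂ} (hu : ParamHol S.u₀ θ)
    (hF : JointHol F θ (k - S.u₀ θ)) (d : Option ℕ+) {z₀ c : ℂ} (hz : z₀ + c = coord d θ) :
    AnalyticAt ℂ (fun y : ℂ × ℂ => F (move d θ (y.1 + c)) (y.2 - S.u₀ (move d θ (y.1 + c))))
      (z₀, k) := by
  have h1 : AnalyticAt ℂ (fun y : ℂ × ℂ => y.1 + c) (z₀, k) := analyticAt_fst.add analyticAt_const
  have h2 : AnalyticAt ℂ (fun y : ℂ × ℂ => S.u₀ (move d θ (y.1 + c))) (z₀, k) :=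
    AnalyticAt.fun_comp (g := fun z => S.u₀ (move d θ z)) (f := fun y : ℂ × ℂ => y.1 + c)
      (by rw [hz]; exact hu d) h1
  refine AnalyticAt.fun_comp (g := fun y : ℂ × ℂ => F (move d θ y.1) y.2)
    (f := fun y : ℂ × ℂ => (y.1 + c, y.2 - S.u₀ (move d θ (y.1 + c)))) ?_
    (h1.prod (analyticAt_snd.sub h2))
  simpa [hz] using hF d

theorem deriv_shift {θ : TodaPoint} {k : ℂ} (hu : ParamHol S.u₀ θ)
    (hF : JointHol F θ (k - S.u₀ θ)) (d : Option ℕ+) {z₀ c : ℂ} (hz : z₀ + c = coord d θ) :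
    deriv (fun z => F (move d θ (z + c)) (k - S.u₀ (move d θ (z + c)))) z₀
      = pderiv d (fun η => F η (k - S.u₀ θ)) θ
        - pderiv d S.u₀ θ * deriv (F θ) (k - S.u₀ θ) := by
  have hl : HasDerivAt (fun z => z + c) 1 z₀ := (hasDerivAt_id z₀).add_const c
  have hm : HasDerivAt (fun z => k - S.u₀ (move d θ (z + c))) (-pderiv d S.u₀ θ) z₀ := by
    have h1 := HasDerivAt.comp (h₂ := fun z => S.u₀ (move d θ z)) (h := fun z => z + c) z₀
      (by rw [hz]; exact hu.hasDerivAt d) hl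
    simpa using h1.const_sub k
  have h1 := hasDerivAt_comp₂ (f := fun z q => F (move d θ z) q)
    (by simpa only [hz, move_coord] using (hF d).differentiableAt) hl hm
  rw [h1.deriv]
  simp only [hz, move_coord, pderiv]
  ring

variable {x s k : ℂ} {t : Times}

theorem coord_shiftTime_one (x : ℂ) (t : Times) (s : ℂ) :
    x + t 1 = coord (some 1) (shiftTime x t, s) := by
  simp [coord, shiftTime, add_comm]

theorem coord_shiftTime (x : ℂ) (t : Times) (n : ℕ+) (s : ℂ) :
    t n + (shiftTime x t n - t n) = coord (some n) (shiftTime x t, s) := by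
  simp [coord]

section Shifted

variable (hu : ParamHol S.u₀ (shiftTime x t, s))
  (hF : JointHol F (shiftTime x t, s) (k - S.u₀ (shiftTime x t, s)))
  (hG : JointHol G (shiftTime x t, s) (k - S.u₀ (shiftTime x t, s)))
include hu hF

theorem holAt_shifted : DMKPTriple.HolAt (S.shifted F) x t s k := by
  refine ⟨?_, fun n => ?_, ?_⟩
  · have h1 := analyticAt_shift hu hF (some 1) (coord_shiftTime_one x t s)
    simp only [← mk_shiftTime_eq_move] at h1
    exact h1
  · have h1 := analyticAt_shift hu hF (some n) (coord_shiftTime x t n s)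
    simp only [← mk_shiftTime_update_eq_move] at h1
    exact h1
  · have h1 := analyticAt_shift hu hF none (z₀ := s) (c := 0) (by simp [coord])
    simp only [add_zero] at h1
    exact h1

theorem dX_shifted : dX (S.shifted F) x t s k
    = pderiv (some 1) (fun η => F η (k - S.u₀ (shiftTime x t, s))) (shiftTime x t, s)
      - pderiv (some 1) S.u₀ (shiftTime x t, s)
        * deriv (F (shiftTime x t, s)) (k - S.u₀ (shiftTime x t, s)) := by
  rw [← deriv_shift hu hF (some 1) (coord_shiftTime_one x t s)]
  simp only [← mk_shiftTime_eq_move]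
  rfl

theorem dT_shifted (n : ℕ+) : dT n (S.shifted F) x t s k
    = pderiv (some n) (fun η => F η (k - S.u₀ (shiftTime x t, s))) (shiftTime x t, s)
      - pderiv (some n) S.u₀ (shiftTime x t, s)
        * deriv (F (shiftTime x t, s)) (k - S.u₀ (shiftTime x t, s)) := by
  rw [← deriv_shift hu hF (some n) (coord_shiftTime x t n s)]
  simp only [← mk_shiftTime_update_eq_move]
  rfl

theorem dS_shifted : dS (S.shifted F) x t s k
    = pderiv none (fun η => F η (k - S.u₀ (shiftTime x t, s))) (shiftTime x t, s)
      - pderiv none S.u₀ (shiftTime x t, s)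
        * deriv (F (shiftTime x t, s)) (k - S.u₀ (shiftTime x t, s)) := by
  rw [← deriv_shift hu hF none (z₀ := s) (c := 0) (by simp [coord])]
  simp only [add_zero]
  rfl

omit hu hF in
theorem dK_shifted : dK (S.shifted F) x t s k
    = deriv (F (shiftTime x t, s)) (k - S.u₀ (shiftTime x t, s)) :=
  deriv_comp_sub_const _ _ _

include hG in
theorem poisson_shifted : poisson (S.shifted F) (S.shifted G) x t s k
    = deriv (F (shiftTime x t, s)) (k - S.u₀ (shiftTime x t, s))
        * pderiv (some 1) (fun η => G η (k - S.u₀ (shiftTime x t, s))) (shiftTime x t, s)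
      - pderiv (some 1) (fun η => F η (k - S.u₀ (shiftTime x t, s))) (shiftTime x t, s)
        * deriv (G (shiftTime x t, s)) (k - S.u₀ (shiftTime x t, s)) := by
  simp only [poisson, dX_shifted hu hF, dX_shifted hu hG, dK_shifted]
  ring

omit hF in
include hG in
theorem poisson_shifted_id : poisson (S.shifted fun _ p => p) (S.shifted G) x t s k
    = pderiv (some 1) (fun η => G η (k - S.u₀ (shiftTime x t, s))) (shiftTime x t, s) := by
  rw [poisson_shifted hu (JointHol.id _ _) hG]
  simp [pderiv]

end Shifted

/-- The points `(x, t, s; k)` with parameters in the domain and with `k - u₀` in `N`. -/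
def region (S : DTodaQuadruple) (N : Set ℂ) (x : ℂ) (t : Times) (s : ℂ) : Set ℂ :=
  {k | (shiftTime x t, s) ∈ S.slice ∧ k - S.u₀ (shiftTime x t, s) ∈ N}

theorem HasForm.eventually_region (h : S.HasForm) {N : Set ℂ} (hN : IsOpen N)
    (hk : k ∈ S.region N x t s) :
    (∀ᶠ z in 𝓝 x, k ∈ S.region N z t s) ∧
      (∀ n : ℕ+, ∀ᶠ z in 𝓝 (t n), k ∈ S.region N x (Function.update t n z) s) ∧
      (∀ᶠ z in 𝓝 s, k ∈ S.region N x t z) ∧ ∀ᶠ q in 𝓝 k, q ∈ S.region N x t s := by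
  have key : ∀ (d : Option ℕ+) (z₀ c : ℂ), z₀ + c = coord d (shiftTime x t, s) →
      ∀ᶠ z in 𝓝 z₀, move d (shiftTime x t, s) (z + c) ∈ S.slice ∧
        k - S.u₀ (move d (shiftTime x t, s) (z + c)) ∈ N := by
    intro d z₀ c hz
    have h1 : Tendsto (fun z => z + c) (𝓝 z₀) (𝓝 (coord d (shiftTime x t, s))) := by
      rw [← hz]; exact (continuous_id.add continuous_const).tendsto z₀
    have h2 : ContinuousAt (fun z => k - S.u₀ (move d (shiftTime x t, s) z))
        (coord d (shiftTime x t, s)) :=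
      continuousAt_const.sub (h.paramHol_u hk.1 d).continuousAt
    exact h1.eventually ((h.dirOpen _ hk.1 d).and
      (h2.eventually_mem (hN.mem_nhds (by simpa using hk.2))))
  refine ⟨?_, fun n => ?_, ?_, ?_⟩
  · have h1 := key (some 1) x (t 1) (coord_shiftTime_one x t s)
    simp only [← mk_shiftTime_eq_move] at h1
    exact h1
  · have h1 := key (some n) (t n) _ (coord_shiftTime x t n s)
    simp only [← mk_shiftTime_update_eq_move] at h1
    exact h1
  · have h1 := key none s 0 (by simp [coord])
    simp only [add_zero] at h1
    exact h1
  · have h2 : ContinuousAt (fun q => q - S.u₀ (shiftTime x t, s)) k := by fun_prop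
    filter_upwards [h2.eventually_mem (hN.mem_nhds hk.2)] with q hq using ⟨hk.1, hq⟩

theorem HasForm.derivatives_congr (h : S.HasForm) {N : Set ℂ} (hN : IsOpen N)
    {A B : ℂ → Times → ℂ → ℂ → ℂ}
    (hAB : ∀ x t s, ∀ k ∈ S.region N x t s, A x t s k = B x t s k)
    (hk : k ∈ S.region N x t s) :
    dX A x t s k = dX B x t s k ∧ (∀ n, dT n A x t s k = dT n B x t s k) ∧
      dS A x t s k = dS B x t s k ∧ dK A x t s k = dK B x t s k := by
  obtain ⟨h1, h2, h3, h4⟩ := h.eventually_region hN hk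
  exact ⟨Filter.EventuallyEq.deriv_eq (h1.mono fun _ hz => hAB _ _ _ _ hz),
    fun n => Filter.EventuallyEq.deriv_eq ((h2 n).mono fun _ hz => hAB _ _ _ _ hz),
    Filter.EventuallyEq.deriv_eq (h3.mono fun _ hz => hAB _ _ _ _ hz),
    Filter.EventuallyEq.deriv_eq (h4.mono fun _ hz => hAB _ _ _ _ hz)⟩

end DTodaQuadruple

/-! ### Twistor data and the twistor problem -/

theorem mul_mul_inv_cancel_mid {a : ℂ} (ha : a ≠ 0) (b : ℂ) : a * (b * a⁻¹) = b := by
  field_simp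

theorem isDMKPTwistorData_of_isDTodaTwistorData {D : Set (ℂ × ℂ)} {f g : ℂ → ℂ → ℂ}
    (hfg : IsDTodaTwistorData D f g) :
    IsDMKPTwistorData (dmkpTwistorDomain D f) (fDMKP f) (gDMKP f g) := by
  have hmap : Continuous fun z : ℂ × ℂ × ℂ => (z.1, z.1 * z.2.1) := by fun_prop
  have hmapd : Differentiable ℂ fun z : ℂ × ℂ × ℂ => (z.1, z.1 * z.2.1) := by fun_prop
  have hf : DifferentiableOn ℂ (fun z : ℂ × ℂ × ℂ => f z.1 (z.1 * z.2.1))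
      {z : ℂ × ℂ × ℂ | (z.1, z.1 * z.2.1) ∈ D} :=
    hfg.hol_f.comp hmapd.differentiableOn fun z hz => hz
  have hg : DifferentiableOn ℂ (fun z : ℂ × ℂ × ℂ => g z.1 (z.1 * z.2.1))
      {z : ℂ × ℂ × ℂ | (z.1, z.1 * z.2.1) ∈ D} :=
    hfg.hol_g.comp hmapd.differentiableOn fun z hz => hz
  have hsub : dmkpTwistorDomain D f ⊆ {z : ℂ × ℂ × ℂ | (z.1, z.1 * z.2.1) ∈ D} := fun z hz => hz.1
  refine ⟨?_, hf.mono hsub, ?_, fun k x s hz => ?_⟩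
  · exact hf.continuousOn.isOpen_inter_preimage (hfg.isOpen.preimage hmap) isOpen_ne
  · exact ((hg.mono hsub).sub (by fun_prop)).mul ((hf.mono hsub).inv fun z hz => hz.2)
  · have hmem : (k, k * x) ∈ D := hz.1
    have hfk := hfg.hol_f.differentiableAt (hfg.isOpen.mem_nhds hmem)
    have hgk := hfg.hol_g.differentiableAt (hfg.isOpen.mem_nhds hmem)
    have hx : HasDerivAt (fun q => q * x) x k := by simpa using (hasDerivAt_id k).mul_const x
    have hk : HasDerivAt (fun y => k * y) k x := by simpa using (hasDerivAt_id x).const_mul k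
    have f1 := hasDerivAt_comp₂ (l := fun q => q) hfk (hasDerivAt_id k) hx
    have g1 := hasDerivAt_comp₂ (l := fun q => q) hgk (hasDerivAt_id k) hx
    have f2 := hasDerivAt_comp₂ (l := fun _ => k) hfk (hasDerivAt_const x k) hk
    have g2 := hasDerivAt_comp₂ (l := fun _ => k) hgk (hasDerivAt_const x k) hk
    have hne : f k (k * x) ≠ 0 := hz.2
    have hbr := hfg.bracket k (k * x) hmem
    simp only [fDMKP, gDMKP]
    rw [f1.deriv, f2.deriv, ((g1.sub_const s).fun_mul (f1.fun_inv hne)).deriv,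
      ((g2.sub_const s).fun_mul (f2.fun_inv hne)).deriv]
    field_simp
    linear_combination (f k (k * x)) * hbr

namespace DTodaQuadruple

variable {S : DTodaQuadruple} {D : Set (ℂ × ℂ)} {f g : ℂ → ℂ → ℂ}

/-- `g_dmKP(L, M, s)` in the Toda variables. -/
def hatM (S : DTodaQuadruple) (θ : TodaPoint) (p : ℂ) : ℂ := (S.Mb₀ θ p - θ.2) * (S.Lb₀ θ p)⁻¹

theorem HasForm.jointHol_hatM (h : S.HasForm) {θ : TodaPoint} (hθ : θ ∈ S.slice) {p : ℂ}
    (hp : p ∈ ringSet S.r S.R) : JointHol S.hatM θ p := by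
  have hs : ParamHol (fun θ => θ.2) θ := by
    rintro (_ | n)
    · exact analyticAt_id
    · exact analyticAt_const
  exact ((h.jointHol_Mb hθ hp).sub (hs.jointHol p)).mul
    ((h.jointHol_Lb hθ hp).inv (h.Lb₀_ne_zero hθ hp))

section

variable (h : S.IsTwistorSolution D f g) {x s k : ℂ} {t : Times}
  (hk : k ∈ S.region (ringSet S.r S.R) x t s)
include h hk

theorem IsTwistorSolution.toDMKP_arguments :
    S.toDMKP.L x t s k * S.toDMKP.M x t s k
        = S.M₀ (shiftTime x t, s) (k - S.u₀ (shiftTime x t, s)) :=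
  mul_mul_inv_cancel_mid (h.form.L₀_ne_zero hk.1 hk.2.1) _

theorem IsTwistorSolution.f_toDMKP :
    f (S.toDMKP.L x t s k) (S.toDMKP.L x t s k * S.toDMKP.M x t s k)
      = S.shifted S.Lb₀ x t s k := by
  rw [h.toDMKP_arguments hk]
  exact h.f_eq _ _ _ hk.1 _ hk.2.1 hk.2.2

theorem IsTwistorSolution.g_toDMKP :
    g (S.toDMKP.L x t s k) (S.toDMKP.L x t s k * S.toDMKP.M x t s k)
      = S.shifted S.Mb₀ x t s k := by
  rw [h.toDMKP_arguments hk]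
  exact h.g_eq _ _ _ hk.1 _ hk.2.1 hk.2.2

theorem IsTwistorSolution.comp_f :
    S.toDMKP.comp (fDMKP f) x t s k = S.shifted S.Lb₀ x t s k := h.f_toDMKP hk

theorem IsTwistorSolution.comp_g :
    S.toDMKP.comp (gDMKP f g) x t s k = S.shifted S.hatM x t s k := by
  simp only [DMKPTriple.comp, gDMKP]
  rw [h.f_toDMKP hk, h.g_toDMKP hk]
  rfl

omit h hk in
theorem comp_partialS_f (x : ℂ) (t : Times) (s k : ℂ) :
    S.toDMKP.comp (DMKPTriple.partialS (fDMKP f)) x t s k = 0 := by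
  simp [DMKPTriple.comp, DMKPTriple.partialS, fDMKP]

theorem IsTwistorSolution.comp_partialS_g :
    S.toDMKP.comp (DMKPTriple.partialS (gDMKP f g)) x t s k = -(S.shifted S.Lb₀ x t s k)⁻¹ := by
  simp only [DMKPTriple.comp, DMKPTriple.partialS, gDMKP]
  rw [h.f_toDMKP hk, (((hasDerivAt_id' s).const_sub _).mul_const _).deriv]
  simp

end

/-- The flow condition for a function that extends to the disc together with its derivatives. -/
theorem HasForm.neg_flow (h : S.HasForm) {F : TodaPoint → ℂ → ℂ} {A : ℂ → Times → ℂ → ℂ → ℂ}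
    (hF : ∀ θ ∈ S.slice, ∀ p ∈ ringSet S.r S.R, JointHol F θ p)
    (hFn : ∀ θ ∈ S.slice, NegPartVanishes 0 S.r S.R (F θ))
    (hA : ∀ x t s, ∀ k ∈ S.region (ringSet S.r S.R) x t s, A x t s k = S.shifted F x t s k)
    {x : ℂ} {t : Times} {s : ℂ} (hθ : (shiftTime x t, s) ∈ S.slice) :
    NegPartVanishes (S.u₀ (shiftTime x t, s)) S.r S.R (fun k =>
      S.toDMKP.P x t s k * dS A x t s k + poisson S.toDMKP.P A x t s k) := by
  have hu := h.paramHol_u hθ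
  have hd := fun d => NegPartVanishes.pderiv h.r_nonneg h.r_lt_R h.dirOpen hF hFn hθ d
  have hid : NegPartVanishes 0 S.r S.R (fun p => p) := .of_differentiableOn differentiableOn_id
  refine (((hid.mul ((hd none).sub ((NegPartVanishes.const 0 S.r S.R
    (pderiv none S.u₀ (shiftTime x t, s))).mul (hFn _ hθ).deriv))).add
    (hd (some 1))).shift (S.u₀ (shiftTime x t, s))).congr fun k h1 h2 => ?_
  have hk : k ∈ S.region (ringSet S.r S.R) x t s := ⟨hθ, h1, h2⟩
  obtain ⟨c1, -, c3, c4⟩ := h.derivatives_congr (isOpen_ringSet _ _) hA hk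
  have h3 : poisson S.toDMKP.P A x t s k = poisson (S.shifted fun _ p => p) (S.shifted F) x t s k := by
    simp only [poisson, c1, c4]
    rfl
  rw [h3, c3, dS_shifted hu (hF _ hθ _ hk.2), poisson_shifted_id hu (hF _ hθ _ hk.2)]
  rfl

theorem IsTwistorSolution.solvesTwistorProblem (h : S.IsTwistorSolution D f g) :
    S.toDMKP.SolvesTwistorProblem (dmkpTwistorDomain D f) (fDMKP f) (gDMKP f g) where
  mem x t s hθ k hk := by
    have hk' : k ∈ S.region (ringSet S.r S.R) x t s := ⟨hθ, hk⟩
    refine ⟨?_, ?_⟩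
    · show (S.toDMKP.L x t s k, S.toDMKP.L x t s k * S.toDMKP.M x t s k) ∈ D
      rw [h.toDMKP_arguments hk']
      exact h.mem _ _ _ hθ _ hk.1 hk.2
    · show f (S.toDMKP.L x t s k) (S.toDMKP.L x t s k * S.toDMKP.M x t s k) ≠ 0
      rw [h.f_toDMKP hk']
      exact h.form.Lb₀_ne_zero hθ hk
  f_neg x t s hθ := ((h.form.neg_Lb hθ).shift _).congr fun _ h1 h2 => h.comp_f ⟨hθ, h1, h2⟩
  g_neg x t s hθ := ((h.form.neg_Mb_div hθ).shift _).congr fun _ h1 h2 => h.comp_g ⟨hθ, h1, h2⟩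
  f_flow x t s hθ := by
    simp only [comp_partialS_f, mul_zero, sub_zero]
    exact h.form.neg_flow (fun _ hθ _ hp => h.form.jointHol_Lb hθ hp)
      (fun _ hθ => h.form.neg_Lb hθ) (fun _ _ _ _ hk => h.comp_f hk) hθ
  g_flow x t s hθ := by
    refine ((h.form.neg_flow (fun _ hθ _ hp => h.form.jointHol_hatM hθ hp)
      (fun _ hθ => h.form.neg_Mb_div hθ) (fun _ _ _ _ hk => h.comp_g hk) hθ).add
      ((h.form.neg_div_Lb (θ := (shiftTime x t, s)) hθ).shift _)).congr fun k h1 h2 => ?_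
    rw [h.comp_partialS_g ⟨hθ, h1, h2⟩, mul_neg, sub_neg_eq_add]
    rfl
  f_reduced x t s _ := by
    simp only [comp_partialS_f, mul_zero]
    exact .const _ _ _ 0
  g_reduced x t s hθ := by
    refine ((NegPartVanishes.const _ _ _ (-1)).mul ((h.form.neg_div_Lb (θ := (shiftTime x t, s)) hθ).shift _)).congr
      fun k h1 h2 => ?_
    rw [h.comp_partialS_g ⟨hθ, h1, h2⟩, mul_neg, neg_one_mul]
    rfl

end DTodaQuadruple

namespace DTodaQuadruple

variable {S : DTodaQuadruple} {D : Set (ℂ × ℂ)} {f g : ℂ → ℂ → ℂ}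

/-! ### The dispersionless mKP hierarchy -/

theorem tendsto_sub_const_cobounded (u : ℂ) :
    Tendsto (fun k => k - u) (Bornology.cobounded ℂ) (Bornology.cobounded ℂ) := by
  rw [← tendsto_norm_atTop_iff_cobounded]
  refine tendsto_atTop_mono (fun k => norm_sub_norm_le k u) ?_
  exact tendsto_atTop_add_const_right _ _ tendsto_norm_cobounded_atTop

/-- The function `M L⁻¹` of the mKP hierarchy, in the Toda variables. -/
def MdivL (S : DTodaQuadruple) (θ : TodaPoint) (p : ℂ) : ℂ := S.M₀ θ p * (S.L₀ θ p)⁻¹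

theorem HasForm.jointHol_MdivL (h : S.HasForm) {θ : TodaPoint} (hθ : θ ∈ S.slice) {p : ℂ}
    (hp : p ∈ ringSet S.r S.R) : JointHol S.MdivL θ p :=
  (h.jointHol_M hθ hp).mul ((h.jointHol_L hθ hp.1).inv (h.L₀_ne_zero hθ hp.1))

theorem HasForm.derivatives_MdivL (h : S.HasForm) {θ : TodaPoint} (hθ : θ ∈ S.slice) {p : ℂ}
    (hp : p ∈ ringSet S.r S.R) :
    deriv (S.MdivL θ) p = deriv (S.M₀ θ) p * (S.L₀ θ p)⁻¹
        + S.M₀ θ p * (-deriv (S.L₀ θ) p / S.L₀ θ p ^ 2) ∧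
      ∀ d, pderiv d (fun θ => S.MdivL θ p) θ
        = pderiv d (fun θ => S.M₀ θ p) θ * (S.L₀ θ p)⁻¹
          + S.M₀ θ p * (-pderiv d (fun θ => S.L₀ θ p) θ / S.L₀ θ p ^ 2) := by
  have hL := h.jointHol_L hθ hp.1
  have hM := h.jointHol_M hθ hp
  have hL0 := h.L₀_ne_zero hθ hp.1
  refine ⟨(hM.hasDerivAt_snd.fun_mul (hL.hasDerivAt_snd.fun_inv hL0)).deriv, fun d => ?_⟩
  have := ((hM.hasDerivAt d).fun_mul ((hL.hasDerivAt d).fun_inv (by simpa using hL0))).deriv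
  simp only [move_coord] at this
  exact this

theorem HasForm.exists_series (h : S.HasForm) {x : ℂ} {t : Times} {s : ℂ}
    (hθ : (shiftTime x t, s) ∈ S.slice) : ∃ a : ℕ+ → ℂ, ∀ᶠ k in Bornology.cobounded ℂ,
      HasSum (fun n : ℕ+ => a n * (k ^ (n : ℕ))⁻¹) (S.toDMKP.L x t s k - k) := by
  set u := S.u₀ (shiftTime x t, s) with hu
  refine HolAtInfty.exists_hasSum (r := S.r + ‖u‖) (by have := h.r_nonneg; positivity) ⟨?_, ?_⟩
  · refine DifferentiableOn.sub ?_ differentiableOn_id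
    refine (h.differentiableOn_L hθ).comp (f := fun k => k - u) (by fun_prop) fun k hk => ?_
    have h1 : S.r + ‖u‖ < ‖k‖ := hk
    show S.r < ‖k - u‖
    linarith [norm_sub_norm_le k u]
  · have h1 := ((h.holAtInfty_L_sub hθ).lim.comp (tendsto_sub_const_cobounded u)).sub_const u
    rw [← hu, sub_self] at h1
    refine h1.congr fun k => ?_
    show S.L₀ (shiftTime x t, s) (k - u) - (k - u) - u = S.L₀ (shiftTime x t, s) (k - u) - k
    ring

theorem summable_update_time {t : Times} {n : ℕ+} {z x : ℂ}
    (hs : Summable fun m : ℕ+ => (m : ℂ) * Function.update t n z m * x ^ (m : ℕ)) :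
    Summable fun m : ℕ+ => (m : ℂ) * t m * x ^ (m : ℕ) := by
  refine (hs.hasSum.update n ((n : ℂ) * t n * x ^ (n : ℕ))).summable.congr fun m => ?_
  by_cases hm : m = n
  · subst hm; simp
  · simp [hm]

/-- The series for `M` divided by `l = L`; the shift of the first time by `x` contributes the
term `x`. -/
theorem series_mul_inv {x s l m : ℂ} {t : Times} {v : ℕ+ → ℂ} (hl : l ≠ 0)
    (hs : Summable fun n : ℕ+ => (n : ℂ) * shiftTime x t n * l ^ (n : ℕ))
    (hm : m = (∑' n : ℕ+, (n : ℂ) * shiftTime x t n * l ^ (n : ℕ)) + s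
      + ∑' n : ℕ+, v n * (l ^ (n : ℕ))⁻¹) :
    (Summable fun n : ℕ+ => (n : ℂ) * t n * l ^ ((n : ℕ) - 1)) ∧
      m * l⁻¹ = (∑' n : ℕ+, (n : ℂ) * t n * l ^ ((n : ℕ) - 1)) + x + s * l⁻¹
        + ∑' n : ℕ+, v n * (l ^ ((n : ℕ) + 1))⁻¹ := by
  have hterm : ∀ n : ℕ+, (n : ℂ) * t n * l ^ (n : ℕ) * l⁻¹
      = (n : ℂ) * t n * l ^ ((n : ℕ) - 1) := fun n => by
    rw [mul_assoc, ← pow_sub_one_mul n.pos.ne', mul_inv_cancel_right₀ hl]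
  refine ⟨((summable_update_time hs).mul_right l⁻¹).congr hterm, ?_⟩
  have h1 : ∑' n : ℕ+, (n : ℂ) * t n * l ^ ((n : ℕ) - 1)
      = (∑' n : ℕ+, (n : ℂ) * t n * l ^ (n : ℕ)) * l⁻¹ := by
    rw [← tsum_mul_right]
    exact tsum_congr fun n => (hterm n).symm
  have h2 : ∑' n : ℕ+, v n * (l ^ ((n : ℕ) + 1))⁻¹
      = (∑' n : ℕ+, v n * (l ^ (n : ℕ))⁻¹) * l⁻¹ := by
    rw [← tsum_mul_right]
    exact tsum_congr fun n => by rw [pow_succ, mul_inv, mul_assoc]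
  have h3 := tsum_update_time hs
  rw [hm, h1, h2]
  simp only [shiftTime] at h3 ⊢
  rw [h3]
  simp only [PNat.one_coe, Nat.cast_one, pow_one]
  field_simp
  ring

theorem HasForm.hasForm_toDMKP (h : S.HasForm) : S.toDMKP.HasForm where
  r_nonneg := h.r_nonneg
  r_lt_R := h.r_lt_R
  dom_open x t s hθ := by
    obtain ⟨h1, h2, h3, -⟩ := h.eventually_region isOpen_univ
      (show (0 : ℂ) ∈ S.region Set.univ x t s from ⟨hθ, trivial⟩)
    exact ⟨h1.mono fun _ hz => hz.1, fun n => (h2 n).mono fun _ hz => hz.1,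
      h3.mono fun _ hz => hz.1⟩
  L_hol x t s hθ k hk :=
    holAt_shifted (F := S.L₀) (h.paramHol_u hθ) (h.jointHol_L hθ hk)
  M_hol x t s hθ k hk :=
    holAt_shifted (F := S.MdivL) (h.paramHol_u hθ) (h.jointHol_MdivL hθ hk)
  P_hol x t s hθ k := holAt_shifted (F := fun _ p => p) (h.paramHol_u hθ) (JointHol.id _ _)
  L_ne x t s hθ k hk := h.L₀_ne_zero (θ := (shiftTime x t, s)) hθ hk
  L_series := by
    choose! a ha using fun x t s (hθ : (shiftTime x t, s) ∈ S.slice) => h.exists_series hθ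
    refine ⟨fun n x t s => a x t s (n - 1), fun x t s hθ => ?_⟩
    filter_upwards [ha x t s hθ] with k hk
    simpa only [PNat.add_sub] using hk
  M_series := by
    refine ⟨fun n x t s => S.v n (shiftTime x t) 0 s, fun x t s hθ => ⟨fun k hk => ?_,
      fun k hk => ?_⟩⟩
    · have h1 := (h.v_summable _ _ _ hθ _ hk).mul_right
        (S.L₀ (shiftTime x t, s) (k - S.u₀ (shiftTime x t, s)))⁻¹
      refine h1.congr fun n => ?_
      rw [pow_succ, mul_inv, mul_assoc]
      rfl
    · exact series_mul_inv (h.L_ne _ _ _ hθ _ hk.1) (h.t_summable _ _ _ hθ _ hk.1 hk.2)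
        (h.M_series _ _ _ hθ _ hk.1 hk.2)
  P_form := ⟨fun x t s => -S.u₀ (shiftTime x t, s), fun _ _ _ _ _ => sub_eq_add_neg _ _⟩

theorem HasForm.B_eq (h : S.HasForm) (n : ℕ+) {x : ℂ} {t : Times} {s : ℂ}
    (hθ : (shiftTime x t, s) ∈ S.slice) (k : ℂ) :
    S.toDMKP.B n x t s k = S.shifted (fun θ p => (S.powPoly n θ).eval p) x t s k := by
  have h1 : polyPart (fun q => S.toDMKP.L x t s q ^ (n : ℕ))
      = (S.powPoly n (shiftTime x t, s)).comp
        (Polynomial.X - Polynomial.C (S.u₀ (shiftTime x t, s))) := by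
    refine polyPart_eq _ _ (((h.holAtInfty_powNeg hθ n).lim.comp
      (tendsto_sub_const_cobounded (S.u₀ (shiftTime x t, s)))).congr' ?_)
    filter_upwards [(tendsto_sub_const_cobounded (S.u₀ (shiftTime x t, s))).eventually
      (eventually_cobounded_mem_outerSet S.r)] with q hq
    have h2 := pow_eq_eval_add (S := S) n (shiftTime x t, s)
      (ne_zero_of_mem_outerSet h.r_nonneg hq)
    show S.powNeg n (shiftTime x t, s) (q - S.u₀ (shiftTime x t, s))
      = S.L₀ (shiftTime x t, s) (q - S.u₀ (shiftTime x t, s)) ^ (n : ℕ) - _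
    rw [h2]
    simp
  simp only [DMKPTriple.B, h1, shifted]
  simp

section Flows

variable (h : S.HasForm) {x s k : ℂ} {t : Times} (hθ : (shiftTime x t, s) ∈ S.slice)
include h hθ

theorem HasForm.derivatives_B (n : ℕ+) (k : ℂ) :
    dX (S.toDMKP.B n) x t s k
        = (S.powPolyDeriv (some 1) n (shiftTime x t, s)).eval (k - S.u₀ (shiftTime x t, s))
          - pderiv (some 1) S.u₀ (shiftTime x t, s) * (S.powPoly n
            (shiftTime x t, s)).derivative.eval (k - S.u₀ (shiftTime x t, s)) ∧
      dS (S.toDMKP.B n) x t s k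
        = (S.powPolyDeriv none n (shiftTime x t, s)).eval (k - S.u₀ (shiftTime x t, s))
          - pderiv none S.u₀ (shiftTime x t, s) * (S.powPoly n
            (shiftTime x t, s)).derivative.eval (k - S.u₀ (shiftTime x t, s)) ∧
      dK (S.toDMKP.B n) x t s k
        = (S.powPoly n (shiftTime x t, s)).derivative.eval (k - S.u₀ (shiftTime x t, s)) := by
  obtain ⟨c1, -, c3, c4⟩ := h.derivatives_congr isOpen_univ (A := S.toDMKP.B n)
    (B := S.shifted fun θ p => (S.powPoly n θ).eval p) (fun x t s k hk => h.B_eq n hk.1 k)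
    (show k ∈ S.region Set.univ x t s from ⟨hθ, trivial⟩)
  have hu := h.paramHol_u hθ
  have hB := h.jointHol_powPoly hθ n (k - S.u₀ (shiftTime x t, s))
  rw [c1, c3, c4, dX_shifted hu hB, dS_shifted hu hB, dK_shifted, h.pderiv_powPoly hθ,
    h.pderiv_powPoly hθ, Polynomial.deriv]
  exact ⟨rfl, rfl, rfl⟩

end Flows

section Twistor

variable (hfg : IsDTodaTwistorData D f g) (h : S.IsTwistorSolution D f g)
include hfg h

/-- A function that evolves by the Toda flows evolves by the mKP flows. The first Toda flow becomes
the equation with `P`. -/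
theorem IsTwistorSolution.dT_shifted_eq_poisson {F : TodaPoint → ℂ → ℂ} {x s k : ℂ} {t : Times}
    (hθ : (shiftTime x t, s) ∈ S.slice)
    (hF : JointHol F (shiftTime x t, s) (k - S.u₀ (shiftTime x t, s))) (n : ℕ+)
    (hflow : ∀ m : ℕ+, pderiv (some m) (fun θ => F θ (k - S.u₀ (shiftTime x t, s))) (shiftTime x t, s)
      = (k - S.u₀ (shiftTime x t, s))
        * ((S.powPoly m (shiftTime x t, s)).derivative.eval (k - S.u₀ (shiftTime x t, s))
          * pderiv none (fun θ => F θ (k - S.u₀ (shiftTime x t, s))) (shiftTime x t, s)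
        - (S.powPolyDeriv none m (shiftTime x t, s)).eval (k - S.u₀ (shiftTime x t, s))
          * deriv (F (shiftTime x t, s)) (k - S.u₀ (shiftTime x t, s)))) :
    dT n (S.shifted F) x t s k = poisson (S.toDMKP.B n) (S.shifted F) x t s k ∧
      dS (S.shifted F) x t s k * S.toDMKP.P x t s k
        = poisson S.toDMKP.P (S.shifted F) x t s k := by
  have hu := h.form.paramHol_u hθ
  have h1 := hflow 1
  have hn := hflow n
  have hz := h.zero_curvature hfg hθ n (k - S.u₀ (shiftTime x t, s))
  obtain ⟨b1, -, b3⟩ := h.form.derivatives_B hθ n k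
  have hP : S.toDMKP.P x t s k = k - S.u₀ (shiftTime x t, s) := rfl
  have hP' : poisson S.toDMKP.P (S.shifted F) x t s k = _ := poisson_shifted_id hu hF
  simp only [PNat.one_coe, h.form.powPoly_one hθ, h.form.powPolyDeriv_one hθ,
    Polynomial.derivative_add, Polynomial.derivative_X, Polynomial.derivative_C, add_zero,
    Polynomial.eval_one, one_mul] at h1
  constructor
  · rw [dT_shifted hu hF, poisson, b1, b3, dX_shifted hu hF, dK_shifted]
    linear_combination hn
      - (S.powPoly n (shiftTime x t, s)).derivative.eval (k - S.u₀ (shiftTime x t, s)) * h1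
      + deriv (F (shiftTime x t, s)) (k - S.u₀ (shiftTime x t, s)) * hz
  · rw [hP', dS_shifted hu hF, hP]
    linear_combination -h1

variable {θ : TodaPoint} (hθ : θ ∈ S.slice) {p : ℂ} (hp : p ∈ ringSet S.r S.R)
include hθ hp

theorem IsTwistorSolution.lax_MdivL (n : ℕ+) :
    pderiv (some n) (fun θ => S.MdivL θ p) θ
      = p * ((S.powPoly n θ).derivative.eval p * pderiv none (fun θ => S.MdivL θ p) θ
        - (S.powPolyDeriv none n θ).eval p * deriv (S.MdivL θ) p) := by
  obtain ⟨e2, e1⟩ := h.form.derivatives_MdivL hθ hp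
  rw [e1, e1, e2, h.lax_L_ring hfg hθ n hp, h.lax_M_ring hfg hθ n hp]
  ring

theorem IsTwistorSolution.bracket_MdivL :
    deriv (S.L₀ θ) p * pderiv (some 1) (fun θ => S.MdivL θ p) θ
      - pderiv (some 1) (fun θ => S.L₀ θ p) θ * deriv (S.MdivL θ) p = 1 := by
  have hL0 := h.form.L₀_ne_zero hθ hp.1
  obtain ⟨a, ha, had⟩ := h.form.exists_deriv_M hθ hp
  have hJ := h.jacobianP_some hfg hθ 1 hp
  simp only [PNat.one_coe, h.form.powPoly_one hθ, Polynomial.derivative_add,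
    Polynomial.derivative_X, Polynomial.derivative_C, add_zero, Polynomial.eval_one,
    mul_one] at hJ
  obtain ⟨e2, e1⟩ := h.form.derivatives_MdivL hθ hp
  rw [e1, e2, had, ha]
  simp only [jacobianP, reducedDeriv] at hJ
  field_simp
  linear_combination S.L₀ θ p * hJ

end Twistor

theorem IsTwistorSolution.isSolution (hfg : IsDTodaTwistorData D f g)
    (h : S.IsTwistorSolution D f g) : S.toDMKP.IsSolution where
  form := h.form.hasForm_toDMKP
  lax_L _ _ _ hθ n _ hk := (h.dT_shifted_eq_poisson hfg (F := S.L₀) hθ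
    (h.form.jointHol_L hθ hk) n fun m => h.lax_L hfg hθ m hk).1
  lax_M _ _ _ hθ n _ hk := (h.dT_shifted_eq_poisson hfg (F := S.MdivL) hθ
    (h.form.jointHol_MdivL hθ hk) n fun m => h.lax_MdivL hfg hθ hk m).1
  ccr x t s hθ k hk := by
    have h1 : poisson S.toDMKP.L S.toDMKP.M x t s k = _ :=
      poisson_shifted (F := S.L₀) (G := S.MdivL) (h.form.paramHol_u (θ := (shiftTime x t, s)) hθ)
        (h.form.jointHol_L hθ hk.1) (h.form.jointHol_MdivL hθ hk)
    rw [h1]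
    exact h.bracket_MdivL hfg hθ hk
  L_P _ _ _ hθ _ hk := (h.dT_shifted_eq_poisson hfg (F := S.L₀) hθ
    (h.form.jointHol_L hθ hk) 1 fun m => h.lax_L hfg hθ m hk).2
  M_P _ _ _ hθ _ hk := (h.dT_shifted_eq_poisson hfg (F := S.MdivL) hθ
    (h.form.jointHol_MdivL hθ hk) 1 fun m => h.lax_MdivL hfg hθ hk m).2
  B_P x t s hθ n k := by
    have hu := h.form.paramHol_u (θ := (shiftTime x t, s)) hθ
    have hid := JointHol.id (shiftTime x t, s) (k - S.u₀ (shiftTime x t, s))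
    have e0 : ∀ d, pderiv d (fun _ => k - S.u₀ (shiftTime x t, s)) (shiftTime x t, s) = 0 :=
      fun d => by simp [pderiv]
    have e1 : deriv (fun p : ℂ => p) (k - S.u₀ (shiftTime x t, s)) = 1 := by simp
    have hT : dT n S.toDMKP.P x t s k = _ := dT_shifted (F := fun _ p => p) hu hid n
    have hX : dX S.toDMKP.P x t s k = _ := dX_shifted (F := fun _ p => p) hu hid
    have hK : dK S.toDMKP.P x t s k = _ := dK_shifted (F := fun _ p => p)
    have hP : S.toDMKP.P x t s k = k - S.u₀ (shiftTime x t, s) := rfl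
    have hz := h.zero_curvature hfg (θ := (shiftTime x t, s)) hθ n (k - S.u₀ (shiftTime x t, s))
    obtain ⟨b1, b2, b3⟩ := h.form.derivatives_B hθ n k
    rw [poisson, b1, b2, b3, hT, hX, hK, hP, e0, e0, e1]
    linear_combination hz

end DTodaQuadruple

end

theorem mainTheorem3 (D : Set (ℂ × ℂ)) (f g : ℂ → ℂ → ℂ) (hfg : IsDTodaTwistorData D f g) :
    IsDMKPTwistorData (dmkpTwistorDomain D f) (fDMKP f) (gDMKP f g) ∧
    ∀ S : DTodaQuadruple, S.IsTwistorSolution D f g →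
      S.toDMKP.SolvesTwistorProblem (dmkpTwistorDomain D f) (fDMKP f) (gDMKP f g) ∧
      S.toDMKP.IsSolution :=
  ⟨isDMKPTwistorData_of_isDTodaTwistorData hfg, fun _ h =>
    ⟨h.solvesTwistorProblem, h.isSolution hfg⟩⟩
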